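/- **Theorem 1.2 (Uniqueness result).** For every integer $d\ge 1$ there is a constant $\mu_0=\mu_0(d)$, depending only on $d$, such that the following holds. Let $u\in C^1([0,1],\ell^2(\mathbb{Z}^d))$ be complex-valued and let $V_j(t)$, $t\in[0,1]$, $j\in\mathbb{Z}^d$, be a bounded complex-valued potential, i.e. $\sup_{t\in[0,1],\,j\in\mathbb{Z}^d}|V_j(t)|<\infty$, such that $$|i\partial_t u_j(t)+\Delta_d u_j(t)|\le |V_j(t)u_j(t)|,\qquad t\in[0,1],\ j\in\mathbb{Z}^d,$$ where $\Delta_d u_j=\sum_{k=1}^d(u_{j+e_k}+u_{j-e_k}-2u_j)$ is the discrete Laplacian and $e_1,\dots,e_d$ is the standard basis. If for some $\mu>\mu_0$ $$\sum_{j\in\mathbb{Z}^d}e^{2\mu|j|\log(|j|+1)}\big(|u_j(0)|^2+|u_j(1)|^2\big)<+\infty,$$ where $|j|$ is the Euclidean norm of $j$, then $u\equiv 0$ on $[0,1]$. -/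

import Mathlib

open Set

/-- The discrete Laplace operator on functions on the lattice `ℤ^d`,
`(Δ_d u)_j = ∑_{k=1}^d (u_{j+e_k} + u_{j-e_k} - 2 u_j)`. -/
def discreteLaplacian {d : ℕ} (u : (Fin d → ℤ) → ℂ) (j : Fin d → ℤ) : ℂ :=
  ∑ k : Fin d, (u (j + Pi.single k 1) + u (j - Pi.single k 1) - 2 * u j)

/-- The Euclidean norm `|j|` of a lattice point `j ∈ ℤ^d`. -/
noncomputable def latticeNorm {d : ℕ} (j : Fin d → ℤ) : ℝ :=
  ‖(WithLp.toLp 2 (fun k => (j k : ℝ)) : EuclideanSpace ℝ (Fin d))‖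

/-- The Hilbert space `ℓ²(ℤ^d)` of square summable complex functions on `ℤ^d`. -/
abbrev EllTwo (d : ℕ) : Type := lp (fun _ : Fin d → ℤ => ℂ) 2

/-! The proof is a Carleman argument with the weight exp(-β(t - t₀)² + W), W = a x_k + κ x_k²/2,
convex in one coordinate. The weighted solution satisfies g' = i M g + b g + F, where M = e^W Δ
e^{-W} and b = -2β(t - t₀). With S the symmetric part of i M + b, the derivative of ⟨g, S g⟩ is at
least (‖M g‖² - ‖M* g‖²)/2 - 2β‖g‖² - ‖F‖²/2 (`virial_deriv`). The difference of squares is a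
commutator, and on the lattice the linear slope amplifies the convexity to about 2κ e^{2a}
(`commutator_lower_bound`, `le_commDiag`). For a = 3 log n and κ = n⁻⁴ this has order n², which
leaves room for β of order n².

Suppose u(t₀, j₀) ≠ 0 with 0 < t₀ < 1. Truncate to |j_l| ≤ n⁴ and integrate over [0,1]
(`carleman_inequality`). Times within δ of t₀ contribute at least e^{-2βδ²}, up to a power of n. The
endpoint terms carry e^{-2βc²}, where c is the distance from t₀ to {0, 1}, and only e^{O(n log n)}
besides, because the decay e^{-4|j| log(|j|+1)} outruns n^{4|j|} once |j| ≥ n. The cutoff terms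
involve u at sites with some |m_i| ≥ n⁴; there the decay at time 0, propagated to later times at the
cost e^{(4d+L)n⁴} (`IsSchrodingerSolution.norm_le_weight`), beats the weight by n^{-n⁴}. Since δ <
c, letting n → ∞ gives a contradiction. -/

open scoped ComplexConjugate InnerProductSpace

/-! ### Finitely supported states: inner product, multiplication operators, shifts -/

/-- Finitely supported complex functions, to be equipped with the `ℓ²` inner product. -/
def FinState (α : Type*) : Type _ := α →₀ ℂ

namespace FinState

variable {α : Type*}

noncomputable instance : AddCommGroup (FinState α) := inferInstanceAs (AddCommGroup (α →₀ ℂ))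

noncomputable instance : Module ℂ (FinState α) := inferInstanceAs (Module ℂ (α →₀ ℂ))

instance : FunLike (FinState α) α ℂ := inferInstanceAs (FunLike (α →₀ ℂ) α ℂ)

/-- The support of a finitely supported function. -/
def supp (f : FinState α) : Finset α := Finsupp.support f

@[ext] theorem ext {f g : FinState α} (h : ∀ j, f j = g j) : f = g := DFunLike.ext _ _ h

@[simp] theorem add_apply (f g : FinState α) (j : α) : (f + g) j = f j + g j := rfl
@[simp] theorem sub_apply (f g : FinState α) (j : α) : (f - g) j = f j - g j := rfl
@[simp] theorem zero_apply (j : α) : (0 : FinState α) j = 0 := rfl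
@[simp] theorem smul_apply (c : ℂ) (f : FinState α) (j : α) : (c • f) j = c * f j := rfl

/-- Evaluation at a point, as a linear map. -/
noncomputable def eval (j : α) : FinState α →ₗ[ℂ] ℂ := Finsupp.lapply (M := ℂ) (R := ℂ) j

@[simp] theorem sum_apply {ι : Type*} (s : Finset ι) (f : ι → FinState α) (j : α) :
    (∑ i ∈ s, f i) j = ∑ i ∈ s, f i j := 
  map_sum (eval j) f s

theorem mem_supp {f : FinState α} {j : α} : j ∈ f.supp ↔ f j ≠ 0 := Finsupp.mem_support_iff

noncomputable instance : Inner ℂ (FinState α) := ⟨fun f g => ∑ j ∈ f.supp, conj (f j) * g j⟩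

theorem inner_def (f g : FinState α) : ⟪f, g⟫_ℂ = ∑ j ∈ f.supp, conj (f j) * g j := rfl

theorem inner_eq_sum {f : FinState α} {s : Finset α} (h : ∀ j ∉ s, f j = 0) (g : FinState α) :
    ⟪f, g⟫_ℂ = ∑ j ∈ s, conj (f j) * g j := by
  rw [inner_def]
  refine Finset.sum_subset (fun j hj => ?_) (fun j _ hj => ?_)
  · by_contra hjs
    exact mem_supp.1 hj (h j hjs)
  · rw [mem_supp, not_not] at hj
    simp [hj]

theorem inner_eq_sum_union [DecidableEq α] (f g : FinState α) :
    ⟪f, g⟫_ℂ = ∑ j ∈ f.supp ∪ g.supp, conj (f j) * g j :=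
  inner_eq_sum (fun j hj => by
    have : j ∉ f.supp := fun h => hj (Finset.mem_union_left _ h)
    simpa [mem_supp] using this) g

theorem inner_self_re (f : FinState α) : (⟪f, f⟫_ℂ).re = ∑ j ∈ f.supp, ‖f j‖ ^ 2 := by
  rw [inner_def, Complex.re_sum]
  refine Finset.sum_congr rfl fun j _ => ?_
  rw [← Complex.normSq_eq_conj_mul_self, Complex.ofReal_re, Complex.normSq_eq_norm_sq]

/-- The `ℓ²` inner product on finitely supported functions. -/
@[reducible] noncomputable def core : InnerProductSpace.Core ℂ (FinState α) where
  conj_inner_symm f g := by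
    classical
    rw [inner_eq_sum_union, inner_eq_sum_union f g, map_sum, Finset.union_comm]
    exact Finset.sum_congr rfl fun j _ => by simp [mul_comm]
  re_inner_nonneg f := by
    change 0 ≤ (⟪f, f⟫_ℂ).re
    rw [inner_self_re]
    positivity
  add_left f g h := by
    classical
    rw [inner_eq_sum (s := f.supp ∪ g.supp), inner_eq_sum (f := f) (s := f.supp ∪ g.supp),
      inner_eq_sum (f := g) (s := f.supp ∪ g.supp), ← Finset.sum_add_distrib]
    · exact Finset.sum_congr rfl fun j _ => by simp [add_mul]
    all_goals
      intro j hj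
      simp only [Finset.mem_union, mem_supp, not_or, not_not] at hj
      simp [hj.1, hj.2]
  smul_left f g c := by
    rw [inner_eq_sum (f := c • f) (s := f.supp), inner_def, Finset.mul_sum]
    · exact Finset.sum_congr rfl fun j _ => by simp [mul_assoc]
    · intro j hj
      rw [mem_supp, not_not] at hj
      simp [hj]
  definite f hf := by
    have h : (⟪f, f⟫_ℂ).re = 0 := by rw [hf]; rfl
    rw [inner_self_re, Finset.sum_eq_zero_iff_of_nonneg (fun _ _ => by positivity)] at h
    ext j
    by_contra hj
    exact hj (by simpa using h j (mem_supp.2 hj))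

noncomputable instance : NormedAddCommGroup (FinState α) := core.toNormedAddCommGroup

noncomputable instance : InnerProductSpace ℂ (FinState α) := InnerProductSpace.ofCore core.toCore

theorem norm_sq_eq_sum {f : FinState α} {s : Finset α} (h : ∀ j ∉ s, f j = 0) :
    ‖f‖ ^ 2 = ∑ j ∈ s, ‖f j‖ ^ 2 := by
  rw [@norm_sq_eq_re_inner ℂ, inner_eq_sum h]
  change (∑ j ∈ s, conj (f j) * f j).re = _
  rw [Complex.re_sum]
  refine Finset.sum_congr rfl fun j _ => ?_
  rw [← Complex.normSq_eq_conj_mul_self, Complex.ofReal_re, Complex.normSq_eq_norm_sq]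

theorem norm_apply_sq_le (f : FinState α) (j : α) : ‖f j‖ ^ 2 ≤ ‖f‖ ^ 2 := by
  classical
  rw [norm_sq_eq_sum (s := insert j f.supp) fun i hi => by
    simpa [mem_supp] using (fun h => hi (Finset.mem_insert_of_mem h) : i ∉ f.supp)]
  exact Finset.single_le_sum (f := fun i => ‖f i‖ ^ 2) (fun _ _ => by positivity)
    (Finset.mem_insert_self j _)

/-- The function `v` cut off to the finite set `s`. -/
noncomputable def cutoff (s : Finset α) (v : α → ℂ) : FinState α :=
  Finsupp.indicator s fun j _ => v j

theorem cutoff_apply [DecidableEq α] (s : Finset α) (v : α → ℂ) (j : α) :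
    cutoff s v j = if j ∈ s then v j else 0 := by
  by_cases h : j ∈ s
  · rw [if_pos h]; exact Finsupp.indicator_of_mem h _
  · rw [if_neg h]; exact Finsupp.indicator_of_notMem h _

theorem cutoff_eq_sum (s : Finset α) (v : α → ℂ) :
    cutoff s v = ∑ j ∈ s, v j • cutoff {j} 1 := by
  classical
  ext i
  simp [cutoff_apply]

/-- Multiplication by a function. -/
noncomputable def mul (a : α → ℂ) : FinState α →ₗ[ℂ] FinState α where
  toFun f := cutoff f.supp (fun j => a j * f j)
  map_add' f g := by
    classical
    ext j
    simp only [cutoff_apply, add_apply, mem_supp]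
    split_ifs <;> simp_all [mul_add]
    -- The case left: the sum vanishes at `j` although neither summand does.
    rename_i h _ _
    rw [← mul_add, h, mul_zero]
  map_smul' c f := by
    classical
    ext j
    simp only [cutoff_apply, smul_apply, mem_supp]
    split_ifs <;> simp_all
    ring

@[simp] theorem mul_apply (a : α → ℂ) (f : FinState α) (j : α) : mul a f j = a j * f j := by
  classical
  change cutoff f.supp (fun j => a j * f j) j = _
  rw [cutoff_apply]
  split_ifs with h
  · rfl
  · rw [mem_supp, not_not] at h
    simp [h]

theorem inner_mul (a : α → ℂ) (ha : ∀ j, conj (a j) = a j) (f g : FinState α) :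
    ⟪mul a f, g⟫_ℂ = ⟪f, mul a g⟫_ℂ := by
  rw [inner_eq_sum (s := f.supp) (f := mul a f), inner_eq_sum (s := f.supp) (f := f)]
  · exact Finset.sum_congr rfl fun j _ => by simp [ha]; ring
  all_goals
    intro j hj
    rw [mem_supp, not_not] at hj
    simp [hj]

variable [AddCommGroup α]

/-- Translation, `(shift e f) j = f (j + e)`. -/
noncomputable def shift (e : α) : FinState α →ₗ[ℂ] FinState α :=
  (Finsupp.domLCongr (M := ℂ) (R := ℂ) (Equiv.subRight e)).toLinearMap

@[simp] theorem shift_apply (e : α) (f : FinState α) (j : α) : shift e f j = f (j + e) := rfl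

theorem inner_shift (e : α) (f g : FinState α) : ⟪shift e f, g⟫_ℂ = ⟪f, shift (-e) g⟫_ℂ := by
  classical
  rw [inner_eq_sum (f := f) (s := f.supp),
    inner_eq_sum (s := f.supp.map (Equiv.subRight e).toEmbedding), Finset.sum_map]
  · simp [sub_eq_add_neg]
  · intro j hj
    simp only [Finset.mem_map_equiv, mem_supp, not_not] at hj
    exact hj
  · intro j hj
    rw [mem_supp, not_not] at hj
    exact hj

theorem norm_shift (e : α) (f : FinState α) : ‖shift e f‖ = ‖f‖ := by
  have h : ⟪shift e f, shift e f⟫_ℂ = ⟪f, f⟫_ℂ := by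
    rw [inner_shift]
    congr 1
    ext j
    simp
  rw [@norm_eq_sqrt_re_inner ℂ, h, ← @norm_eq_sqrt_re_inner ℂ]

end FinState

/-! ### Abstract virial inequality -/

section Virial

variable {E : Type*} [NormedAddCommGroup E] [InnerProductSpace ℂ E]

/-- The generator is `i M + b'`; the functional `re ⟪g, i M g⟫ + b' ‖g‖²` has a derivative bounded
below by the commutator of the symmetric and skew parts. -/
theorem virial_deriv (M M' : E →ₗ[ℂ] E) (hadj : ∀ x y, ⟪M x, y⟫_ℂ = ⟪x, M' y⟫_ℂ)
    {g : ℝ → E} {G F : E} {b : ℝ → ℝ} {b2 : ℝ} {s : Set ℝ} {t : ℝ}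
    (hg : HasDerivWithinAt g G s t) (hMg : HasDerivWithinAt (fun τ => M (g τ)) (M G) s t)
    (hb : HasDerivWithinAt b b2 s t) (hG : G = Complex.I • M (g t) + (b t : ℂ) • g t + F) :
    ∃ D : ℝ, HasDerivWithinAt
        (fun τ => (⟪g τ, Complex.I • M (g τ)⟫_ℂ).re + b τ * ‖g τ‖ ^ 2) D s t ∧
      (‖M (g t)‖ ^ 2 - ‖M' (g t)‖ ^ 2) / 2 + b2 * ‖g t‖ ^ 2 - ‖F‖ ^ 2 / 2 ≤ D := by
  have hadj' : ∀ x y, ⟪M' x, y⟫_ℂ = ⟪x, M y⟫_ℂ := fun x y => by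
    rw [← inner_conj_symm, ← hadj, inner_conj_symm]
  have hn : (fun τ => ‖g τ‖ ^ 2) = fun τ => (⟪g τ, g τ⟫_ℂ).re := by
    ext τ; exact @norm_sq_eq_re_inner ℂ _ _ _ _ _
  have h1 : HasDerivWithinAt (fun τ => (⟪g τ, Complex.I • M (g τ)⟫_ℂ).re)
      (⟪g t, Complex.I • M G⟫_ℂ + ⟪G, Complex.I • M (g t)⟫_ℂ).re s t :=
    Complex.reCLM.hasFDerivAt.comp_hasDerivWithinAt t (hg.inner ℂ (hMg.const_smul Complex.I))
  have h2 : HasDerivWithinAt (fun τ => ‖g τ‖ ^ 2) (⟪g t, G⟫_ℂ + ⟪G, g t⟫_ℂ).re s t := by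
    rw [hn]
    exact Complex.reCLM.hasFDerivAt.comp_hasDerivWithinAt t (hg.inner ℂ hg)
  have h3 := h1.add (hb.mul h2)
  refine ⟨_, h3, ?_⟩
  · simp only [Complex.add_re]
    set x := g t
    set p := M x
    set q := M' x
    -- `r` is S x, with S the symmetric part of the generator; the functional is ⟨g, S g⟩.
    set r : E := (Complex.I / 2) • (p - q) + (b t : ℂ) • x with hr
    have e1 : (⟪x, Complex.I • M G⟫_ℂ).re = (⟪G, -(Complex.I • q)⟫_ℂ).re := by
      have hc : (⟪q, G⟫_ℂ).im = -(⟪G, q⟫_ℂ).im := by rw [← inner_conj_symm, Complex.conj_im]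
      rw [inner_smul_right, ← hadj', inner_neg_right, inner_smul_right]
      change (Complex.I * ⟪q, G⟫_ℂ).re = _
      simp [hc]
    have e2 : (⟪x, G⟫_ℂ).re = (⟪G, x⟫_ℂ).re := by
      rw [← inner_conj_symm, Complex.conj_re]
    have hGr : G = (Complex.I / 2) • (p + q) + r + F := by
      rw [hG, hr]
      module
    have e4 : (⟪G, Complex.I • p⟫_ℂ).re + (⟪G, -(Complex.I • q)⟫_ℂ).re
        + b t * (2 * (⟪G, x⟫_ℂ).re) = 2 * (⟪G, r⟫_ℂ).re := by
      simp only [hr, inner_add_right, inner_smul_right, inner_neg_right, inner_sub_right,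
        Complex.add_re, Complex.mul_re, Complex.neg_re, Complex.sub_re, Complex.sub_im,
        Complex.I_re, Complex.I_im, Complex.ofReal_re, Complex.ofReal_im, Complex.div_ofNat_re,
        Complex.div_ofNat_im]
      ring
    -- Skew part against symmetric part: only the commutator survives, and the scalar `b t` drops
    -- out.
    have e5 : 2 * (⟪(Complex.I / 2) • (p + q), r⟫_ℂ).re = (‖p‖ ^ 2 - ‖q‖ ^ 2) / 2 := by
      have hpq : (⟪p, q⟫_ℂ).re = (⟪q, p⟫_ℂ).re := by
        rw [← inner_conj_symm, Complex.conj_re]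
      have hqx : (⟪p, x⟫_ℂ).im = -(⟪q, x⟫_ℂ).im := by
        rw [hadj x x, hadj' x x, ← hadj, ← inner_conj_symm, Complex.conj_im]
      have hp : (⟪p, p⟫_ℂ).re = ‖p‖ ^ 2 := (@norm_sq_eq_re_inner ℂ _ _ _ _ _).symm
      have hq : (⟪q, q⟫_ℂ).re = ‖q‖ ^ 2 := (@norm_sq_eq_re_inner ℂ _ _ _ _ _).symm
      rw [← hp, ← hq]
      simp only [hr, inner_add_right, inner_smul_right, inner_smul_left, inner_add_left,
        inner_sub_right, Complex.add_re, Complex.mul_re, Complex.sub_re, Complex.sub_im,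
        Complex.mul_im, Complex.add_im, map_div₀, Complex.conj_I, Complex.neg_re, Complex.neg_im,
        Complex.I_re, Complex.I_im, Complex.ofReal_re, Complex.ofReal_im, Complex.div_ofNat_re,
        Complex.div_ofNat_im, Complex.conj_ofNat]
      rw [hqx]
      linear_combination (-1 / 2 : ℝ) * hpq
    have e6 : (⟪r, r⟫_ℂ).re = ‖r‖ ^ 2 := (@norm_sq_eq_re_inner ℂ _ _ _ _ _).symm
    have e7 : -(‖F‖ * ‖r‖) ≤ (⟪F, r⟫_ℂ).re := by
      have := (Complex.abs_re_le_norm ⟪F, r⟫_ℂ).trans (norm_inner_le_norm F r)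
      exact (abs_le.1 this).1
    have e8 : (⟪G, r⟫_ℂ).re = (⟪(Complex.I / 2) • (p + q), r⟫_ℂ).re + ‖r‖ ^ 2
        + (⟪F, r⟫_ℂ).re := by
      conv_lhs => rw [hGr]
      rw [inner_add_left, inner_add_left, Complex.add_re, Complex.add_re, e6]
    rw [e1, e2]
    -- The gain 2‖r‖² absorbs the forcing: 2‖r‖² - 2‖F‖‖r‖ ≥ -‖F‖²/2.
    nlinarith [sq_nonneg (‖F‖ - 2 * ‖r‖)]

end Virial

/-! ### The conjugated Laplacian and its commutator -/

namespace FinState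

section Conjugation

variable {d : ℕ}

/-- The ratio `exp (W (j + e) - W j)` of consecutive values of the weight `exp W`, where
`W j = a * j k + κ * (j k) ^ 2 / 2` and `e` is the `k`-th basis vector. -/
noncomputable def weightRatio (a κ : ℝ) (k : Fin d) (j : Fin d → ℤ) : ℂ :=
  (Real.exp (a + κ * ((j k : ℝ) + 1 / 2)) : ℂ)

/-- The hops transverse to the direction `k`, and the diagonal part of the Laplacian. -/
noncomputable def transverse (k : Fin d) : Module.End ℂ (FinState (Fin d → ℤ)) :=
  ∑ l ∈ Finset.univ.erase k, (shift (Pi.single l 1) + shift (-Pi.single l 1)) - (2 * d : ℂ) • 1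

/-- The hops along the direction `k` after conjugation with the weight. -/
noncomputable def conjHop (a κ : ℝ) (k : Fin d) : Module.End ℂ (FinState (Fin d → ℤ)) :=
  shift (-Pi.single k 1) * mul (weightRatio a κ k)
    + mul (fun j => (weightRatio a κ k j)⁻¹) * shift (Pi.single k 1)

/-- The formal adjoint of `conjHop`. -/
noncomputable def conjHopAdj (a κ : ℝ) (k : Fin d) : Module.End ℂ (FinState (Fin d → ℤ)) :=
  mul (weightRatio a κ k) * shift (Pi.single k 1)
    + shift (-Pi.single k 1) * mul (fun j => (weightRatio a κ k j)⁻¹)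

/-- The Laplacian conjugated with the weight `exp W`. -/
noncomputable def conjLaplacian (a κ : ℝ) (k : Fin d) : Module.End ℂ (FinState (Fin d → ℤ)) :=
  conjHop a κ k + transverse k

/-- The formal adjoint of `conjLaplacian`. -/
noncomputable def conjLaplacianAdj (a κ : ℝ) (k : Fin d) :
    Module.End ℂ (FinState (Fin d → ℤ)) :=
  conjHopAdj a κ k + transverse k

theorem conj_weightRatio (a κ : ℝ) (k : Fin d) (j : Fin d → ℤ) :
    conj (weightRatio a κ k j) = weightRatio a κ k j := Complex.conj_ofReal _

theorem weightRatio_ne_zero (a κ : ℝ) (k : Fin d) (j : Fin d → ℤ) : weightRatio a κ k j ≠ 0 :=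
  Complex.ofReal_ne_zero.2 (Real.exp_pos _).ne'

theorem weightRatio_add_single (a κ : ℝ) (k : Fin d) (j : Fin d → ℤ) :
    weightRatio a κ k (j + Pi.single k 1) = Real.exp κ * weightRatio a κ k j := by
  rw [weightRatio, weightRatio, ← Complex.ofReal_mul, ← Real.exp_add]
  congr 2
  simp
  ring

theorem weightRatio_sub_single (a κ : ℝ) (k : Fin d) (j : Fin d → ℤ) :
    weightRatio a κ k (j - Pi.single k 1) = Real.exp (-κ) * weightRatio a κ k j := by
  rw [weightRatio, weightRatio, ← Complex.ofReal_mul, ← Real.exp_add]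
  congr 2
  simp
  ring

theorem weightRatio_add_of_ne (a κ : ℝ) {k l : Fin d} (h : l ≠ k) (j : Fin d → ℤ) (c : ℤ) :
    weightRatio a κ k (j + Pi.single l c) = weightRatio a κ k j := by
  simp [weightRatio, Pi.single_eq_of_ne h.symm]

theorem commute_shift (e e' : Fin d → ℤ) :
    Commute (shift e : Module.End ℂ (FinState (Fin d → ℤ))) (shift e') := by
  ext f j
  simp [add_right_comm]

theorem commute_shift_mul {e : Fin d → ℤ} {w : (Fin d → ℤ) → ℂ} (h : ∀ j, w (j + e) = w j) :
    Commute (shift e : Module.End ℂ (FinState (Fin d → ℤ))) (mul w) := by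
  ext f j
  simp [h]

theorem commute_transverse {k : Fin d} {T : Module.End ℂ (FinState (Fin d → ℤ))}
    (h : ∀ l, l ≠ k → ∀ c : ℤ, Commute (shift (Pi.single l c)) T) : Commute (transverse k) T := by
  refine Commute.sub_left (Commute.sum_left _ _ _ fun l hl => ?_)
    ((Commute.one_left T).smul_left _)
  have hl' := Finset.ne_of_mem_erase hl
  refine (h l hl' 1).add_left ?_
  rw [← Pi.single_neg]
  exact h l hl' (-1)

theorem commute_transverse_conjHop (a κ : ℝ) (k : Fin d) :
    Commute (transverse k) (conjHop a κ k) :=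
  commute_transverse fun l hl c =>
    ((commute_shift _ _).mul_right
      (commute_shift_mul fun j => weightRatio_add_of_ne a κ hl j c)).add_right
    ((commute_shift_mul fun j => by rw [weightRatio_add_of_ne a κ hl j c]).mul_right
      (commute_shift _ _))

theorem commute_transverse_conjHopAdj (a κ : ℝ) (k : Fin d) :
    Commute (transverse k) (conjHopAdj a κ k) :=
  commute_transverse fun l hl c =>
    ((commute_shift_mul fun j => weightRatio_add_of_ne a κ hl j c).mul_right
      (commute_shift _ _)).add_right
    ((commute_shift _ _).mul_right
      (commute_shift_mul fun j => by rw [weightRatio_add_of_ne a κ hl j c]))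

/-- The diagonal part of the commutator. -/
noncomputable def commDiag (a κ : ℝ) (k : Fin d) (j : Fin d → ℤ) : ℝ :=
  Real.exp (2 * (a + κ * ((j k : ℝ) + 1 / 2))) - Real.exp (2 * (a + κ * ((j k : ℝ) - 1 / 2)))
    + Real.exp (-(2 * (a + κ * ((j k : ℝ) - 1 / 2))))
    - Real.exp (-(2 * (a + κ * ((j k : ℝ) + 1 / 2))))

theorem commDiag_eq (a κ : ℝ) (k : Fin d) (j : Fin d → ℤ) :
    (commDiag a κ k j : ℂ) = weightRatio a κ k j ^ 2 - weightRatio a κ k (j - Pi.single k 1) ^ 2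
      + (weightRatio a κ k (j - Pi.single k 1))⁻¹ ^ 2 - (weightRatio a κ k j)⁻¹ ^ 2 := by
  have h : weightRatio a κ k (j - Pi.single k 1)
      = (Real.exp (a + κ * ((j k : ℝ) - 1 / 2)) : ℂ) := by
    rw [weightRatio]
    congr 2
    rw [Pi.sub_apply, Pi.single_eq_same]
    push_cast
    ring
  rw [h, weightRatio, commDiag]
  simp only [← Complex.ofReal_inv, ← Real.exp_neg, ← Complex.ofReal_pow, ← Real.exp_nat_mul]
  push_cast
  ring_nf

/-- For a quadratic W, a unit step multiplies the ratio by the constant e^{±κ}. Hence the double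
hops have constant coefficients, small with κ and independent of `a`, while the diagonal grows like
e^{2a}. -/
theorem conjHop_commutator (a κ : ℝ) (k : Fin d) :
    conjHopAdj a κ k * conjHop a κ k - conjHop a κ k * conjHopAdj a κ k
      = mul (fun j => (commDiag a κ k j : ℂ))
        - ((Real.exp κ - Real.exp (-κ) : ℝ) : ℂ) •
          (shift (Pi.single k 1 + Pi.single k 1) + shift (-Pi.single k 1 + -Pi.single k 1)) := by
  ext f j
  have h1 : weightRatio a κ k (j - Pi.single k 1 - Pi.single k 1)
      = Real.exp (-κ) * weightRatio a κ k (j - Pi.single k 1) := weightRatio_sub_single _ _ _ _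
  have h2 := weightRatio_add_single a κ k j
  have n0 := weightRatio_ne_zero a κ k j
  have n1 := weightRatio_ne_zero a κ k (j - Pi.single k 1)
  have hk : (Real.exp κ : ℂ) ≠ 0 := Complex.ofReal_ne_zero.2 (Real.exp_pos _).ne'
  have hk' : (Real.exp (-κ) : ℂ) = (Real.exp κ : ℂ)⁻¹ := by
    rw [Real.exp_neg, Complex.ofReal_inv]
  simp only [conjHopAdj, conjHop, LinearMap.sub_apply, LinearMap.add_apply, Module.End.mul_apply,
    sub_apply, add_apply, mul_apply, shift_apply, LinearMap.smul_apply, smul_apply, commDiag_eq,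
    ← sub_eq_add_neg, add_sub_cancel_right, sub_add_cancel, h1, h2, Complex.ofReal_sub, hk',
    ← add_assoc, ← sub_sub, add_sub_assoc, neg_sub_left]
  generalize weightRatio a κ k j = x at *
  generalize weightRatio a κ k (j - Pi.single k 1) = y at *
  field_simp
  ring_nf

/-- The weight depends on coordinate `k` alone, so the transverse hops commute with everything and
cancel. -/
theorem conjLaplacian_commutator (a κ : ℝ) (k : Fin d) :
    conjLaplacianAdj a κ k * conjLaplacian a κ k - conjLaplacian a κ k * conjLaplacianAdj a κ k
      = conjHopAdj a κ k * conjHop a κ k - conjHop a κ k * conjHopAdj a κ k := by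
  have h1 : transverse k * conjHop a κ k = conjHop a κ k * transverse k :=
    commute_transverse_conjHop a κ k
  have h2 : transverse k * conjHopAdj a κ k = conjHopAdj a κ k * transverse k :=
    commute_transverse_conjHopAdj a κ k
  simp only [conjLaplacian, conjLaplacianAdj, mul_add, add_mul, h1, h2]
  abel

theorem inner_conjLaplacian (a κ : ℝ) (k : Fin d) (f g : FinState (Fin d → ℤ)) :
    ⟪conjLaplacian a κ k f, g⟫_ℂ = ⟪f, conjLaplacianAdj a κ k g⟫_ℂ := by
  simp only [conjLaplacian, conjLaplacianAdj, conjHop, conjHopAdj, transverse,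
    LinearMap.add_apply, LinearMap.sub_apply, LinearMap.sum_apply, LinearMap.smul_apply,
    Module.End.mul_apply, Module.End.one_apply, inner_add_left, inner_add_right, inner_sub_left,
    inner_sub_right, sum_inner, inner_sum, inner_smul_left, inner_smul_right, inner_shift, neg_neg,
    inner_mul (weightRatio a κ k) (conj_weightRatio a κ k),
    inner_mul (fun j => (weightRatio a κ k j)⁻¹) (fun j => by rw [map_inv₀, conj_weightRatio]),
    map_mul, map_ofNat, map_natCast]
  congr 2
  exact Finset.sum_congr rfl fun l _ => add_comm _ _

/-- The diagonal is at least `G` on the support of `g`; the two double shifts are isometries, which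
bounds their cost. -/
theorem commutator_lower_bound (a κ : ℝ) (hκ : 0 ≤ κ) (k : Fin d) {G : ℝ}
    (g : FinState (Fin d → ℤ)) (hG : ∀ j, g j ≠ 0 → G ≤ commDiag a κ k j) :
    (G - 2 * (Real.exp κ - Real.exp (-κ))) * ‖g‖ ^ 2
      ≤ ‖conjLaplacian a κ k g‖ ^ 2 - ‖conjLaplacianAdj a κ k g‖ ^ 2 := by
  have hs : 0 ≤ Real.exp κ - Real.exp (-κ) := by
    have := Real.exp_le_exp.2 (show -κ ≤ κ by linarith)
    linarith
  have hre : ∀ x : FinState (Fin d → ℤ), ‖x‖ ^ 2 = (⟪x, x⟫_ℂ).re := fun x =>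
    @norm_sq_eq_re_inner ℂ _ _ _ _ x
  have h1 : ‖conjLaplacian a κ k g‖ ^ 2 - ‖conjLaplacianAdj a κ k g‖ ^ 2
      = (⟪g, (conjLaplacianAdj a κ k * conjLaplacian a κ k
          - conjLaplacian a κ k * conjLaplacianAdj a κ k) g⟫_ℂ).re := by
    rw [LinearMap.sub_apply, inner_sub_right, Module.End.mul_apply, Module.End.mul_apply,
      ← inner_conjLaplacian, ← inner_conj_symm g (conjLaplacian a κ k _), inner_conjLaplacian,
      Complex.sub_re, Complex.conj_re, inner_conjLaplacian, hre, hre, inner_conjLaplacian,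
      ← inner_conjLaplacian _ _ _ (conjLaplacianAdj a κ k g)]
  have h2 : G * ‖g‖ ^ 2 ≤ (⟪g, mul (fun j => (commDiag a κ k j : ℂ)) g⟫_ℂ).re := by
    have hz : ∀ j ∉ g.supp, g j = 0 := fun j hj => by simpa [mem_supp] using hj
    rw [norm_sq_eq_sum hz, inner_eq_sum hz, Complex.re_sum, Finset.mul_sum]
    refine Finset.sum_le_sum fun j hj => ?_
    have : (conj (g j) * mul (fun j => (commDiag a κ k j : ℂ)) g j).re
        = commDiag a κ k j * ‖g j‖ ^ 2 := by
      rw [mul_apply, mul_left_comm, ← Complex.normSq_eq_conj_mul_self, ← Complex.ofReal_mul,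
        Complex.ofReal_re, Complex.normSq_eq_norm_sq]
    rw [this]
    exact mul_le_mul_of_nonneg_right (hG j (mem_supp.1 hj)) (by positivity)
  have h3 : ∀ e : Fin d → ℤ, (⟪g, shift e g⟫_ℂ).re ≤ ‖g‖ ^ 2 := fun e => by
    refine (Complex.re_le_norm _).trans ((norm_inner_le_norm _ _).trans ?_)
    rw [norm_shift, sq]
  rw [h1, conjLaplacian_commutator, conjHop_commutator]
  simp only [LinearMap.sub_apply, LinearMap.smul_apply, LinearMap.add_apply, inner_sub_right,
    inner_smul_right, inner_add_right, Complex.sub_re, Complex.re_ofReal_mul, Complex.add_re]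
  nlinarith [mul_le_mul_of_nonneg_left
    (add_le_add (h3 (Pi.single k 1 + Pi.single k 1)) (h3 (-Pi.single k 1 + -Pi.single k 1))) hs]

/-- This identifies the operator as e^W Δ e^{-W}; the scalar `c` is there to carry the time factor.
-/
theorem conjLaplacian_apply (a κ : ℝ) (k : Fin d) (f : FinState (Fin d → ℤ)) (j : Fin d → ℤ)
    (v : (Fin d → ℤ) → ℂ) (c : ℂ)
    (hf : ∀ m, f m = c * Real.exp (a * m k + κ * (m k : ℝ) ^ 2 / 2) * v m) :
    conjLaplacian a κ k f j
      = c * Real.exp (a * j k + κ * (j k : ℝ) ^ 2 / 2) * discreteLaplacian v j := by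
  have hE : ∀ x y : ℝ, x = y → (Real.exp x : ℂ) = Real.exp y := fun x y h => by rw [h]
  have h1 : weightRatio a κ k (j - Pi.single k 1) * f (j - Pi.single k 1)
      = c * Real.exp (a * j k + κ * (j k : ℝ) ^ 2 / 2) * v (j - Pi.single k 1) := by
    rw [hf, weightRatio]
    have : (Real.exp (a * j k + κ * (j k : ℝ) ^ 2 / 2) : ℂ)
        = Real.exp (a + κ * (((j - Pi.single k 1 : Fin d → ℤ) k : ℝ) + 1 / 2))
          * Real.exp (a * ((j - Pi.single k 1 : Fin d → ℤ) k : ℝ)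
            + κ * ((j - Pi.single k 1 : Fin d → ℤ) k : ℝ) ^ 2 / 2) := by
      rw [← Complex.ofReal_mul, ← Real.exp_add]
      apply hE
      simp
      ring
    rw [this]
    ring
  have h2 : (weightRatio a κ k j)⁻¹ * f (j + Pi.single k 1)
      = c * Real.exp (a * j k + κ * (j k : ℝ) ^ 2 / 2) * v (j + Pi.single k 1) := by
    rw [hf, inv_mul_eq_iff_eq_mul₀ (weightRatio_ne_zero _ _ _ _), weightRatio]
    have : (Real.exp (a * ((j + Pi.single k 1 : Fin d → ℤ) k : ℝ)
            + κ * ((j + Pi.single k 1 : Fin d → ℤ) k : ℝ) ^ 2 / 2) : ℂ)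
        = Real.exp (a + κ * ((j k : ℝ) + 1 / 2))
          * Real.exp (a * j k + κ * (j k : ℝ) ^ 2 / 2) := by
      rw [← Complex.ofReal_mul, ← Real.exp_add]
      apply hE
      simp
      ring
    rw [this]
    ring
  have h3 : ∀ l ∈ Finset.univ.erase k, f (j + Pi.single l 1) + f (j - Pi.single l 1)
      = c * Real.exp (a * j k + κ * (j k : ℝ) ^ 2 / 2)
        * (v (j + Pi.single l 1) + v (j - Pi.single l 1)) := fun l hl => by
    have hl' : k ≠ l := (Finset.ne_of_mem_erase hl).symm
    rw [hf, hf]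
    simp only [Pi.add_apply, Pi.sub_apply, Pi.single_eq_of_ne hl', add_zero, sub_zero]
    ring
  have h4 : ∑ l, (v (j + Pi.single l 1) + v (j - Pi.single l 1))
      = v (j + Pi.single k 1) + v (j - Pi.single k 1)
        + ∑ l ∈ Finset.univ.erase k, (v (j + Pi.single l 1) + v (j - Pi.single l 1)) :=
    (Finset.add_sum_erase _ _ (Finset.mem_univ k)).symm
  simp only [conjLaplacian, conjHop, transverse, LinearMap.add_apply, LinearMap.sub_apply,
    LinearMap.sum_apply, LinearMap.smul_apply, Module.End.mul_apply, Module.End.one_apply,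
    add_apply, sub_apply, sum_apply, smul_apply, mul_apply, shift_apply, ← sub_eq_add_neg]
  rw [h1, h2, Finset.sum_congr rfl h3, ← Finset.mul_sum, hf j, discreteLaplacian,
    Finset.sum_sub_distrib, h4]
  simp
  ring

end Conjugation

end FinState

/-! ### Propagation of spatial decay in time -/

/-- A bounded solution `u`, with time derivative `u'`, of `|i u' + Δ u| ≤ L |u|` on `[0,1]`. -/
structure IsSchrodingerSolution {d : ℕ} (L U : ℝ) (u u' : ℝ → (Fin d → ℤ) → ℂ) : Prop where
  hasDeriv : ∀ t ∈ Icc (0 : ℝ) 1, ∀ j,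
    HasDerivWithinAt (fun τ => u τ j) (u' t j) (Icc (0 : ℝ) 1) t
  bound : ∀ t ∈ Icc (0 : ℝ) 1, ∀ j, ‖u t j‖ ≤ U
  ineq : ∀ t ∈ Icc (0 : ℝ) 1, ∀ j,
    ‖Complex.I * u' t j + discreteLaplacian (u t) j‖ ≤ L * ‖u t j‖

theorem norm_discreteLaplacian_le {d : ℕ} {v : (Fin d → ℤ) → ℂ} {j : Fin d → ℤ} {B : ℝ}
    (h0 : ‖v j‖ ≤ B) (h1 : ∀ l, ‖v (j + Pi.single l 1)‖ ≤ B)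
    (h2 : ∀ l, ‖v (j - Pi.single l 1)‖ ≤ B) : ‖discreteLaplacian v j‖ ≤ 4 * d * B := by
  have : ∀ l : Fin d, ‖v (j + Pi.single l 1) + v (j - Pi.single l 1) - 2 * v j‖ ≤ 4 * B := by
    intro l
    have a1 := norm_sub_le (v (j + Pi.single l 1) + v (j - Pi.single l 1)) (2 * v j)
    have a2 := norm_add_le (v (j + Pi.single l 1)) (v (j - Pi.single l 1))
    have a3 : ‖2 * v j‖ = 2 * ‖v j‖ := by rw [norm_mul, Complex.norm_ofNat]
    linarith [h1 l, h2 l]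
  refine (norm_sum_le_of_le _ fun l _ => this l).trans ?_
  simp
  linarith

namespace IsSchrodingerSolution

variable {d : ℕ} {L U : ℝ} {u u' : ℝ → (Fin d → ℤ) → ℂ}

theorem norm_deriv_le (h : IsSchrodingerSolution L U u u') (hL : 0 ≤ L) {t : ℝ}
    (ht : t ∈ Icc (0 : ℝ) 1) {j : Fin d → ℤ} {B : ℝ} (h0 : ‖u t j‖ ≤ B)
    (h1 : ∀ l, ‖u t (j + Pi.single l 1)‖ ≤ B) (h2 : ∀ l, ‖u t (j - Pi.single l 1)‖ ≤ B) :
    ‖u' t j‖ ≤ (4 * d + L) * B := by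
  have a1 := norm_sub_le (Complex.I * u' t j + discreteLaplacian (u t) j)
    (discreteLaplacian (u t) j)
  rw [add_sub_cancel_right, norm_mul, Complex.norm_I, one_mul] at a1
  have a2 := norm_discreteLaplacian_le h0 h1 h2
  have a3 := h.ineq t ht j
  have a4 := mul_le_mul_of_nonneg_left h0 hL
  linarith

/-- A weight that is slowly varying from site to site propagates from time `0`. -/
theorem norm_le_weight (h : IsSchrodingerSolution L U u u') (hL : 0 ≤ L)
    {ω : (Fin d → ℤ) → ℝ} {R : ℝ} (hR : 1 ≤ R) (hω : ∀ j, 0 ≤ ω j)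
    (hp : ∀ j l, ω (j + Pi.single l 1) ≤ R * ω j) (hm : ∀ j l, ω (j - Pi.single l 1) ≤ R * ω j)
    (h0 : ∀ j, ‖u 0 j‖ ≤ ω j) {t : ℝ} (ht : t ∈ Icc (0 : ℝ) 1) (j : Fin d → ℤ) :
    ‖u t j‖ ≤ ω j * Real.exp ((4 * d + L) * R * t) := by
  have hU : 0 ≤ U := (norm_nonneg _).trans (h.bound t ht j)
  set C := (4 * d + L) * R with hC
  have hdL : 0 ≤ 4 * d + L := by positivity
  have hC0 : 0 ≤ C := by positivity
  -- Picard iteration from the crude bound `U`: each integration of the differential inequality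
  -- replaces the error by the next Taylor term of U e^{Ct}, which tends to 0.
  have key : ∀ n : ℕ, ∀ t ∈ Icc (0 : ℝ) 1, ∀ j,
      ‖u t j‖ ≤ ω j * Real.exp (C * t) + U * ((C * t) ^ n / n.factorial) := by
    intro n
    induction n with
    | zero =>
      intro t ht j
      have a1 := mul_nonneg (hω j) (Real.exp_pos (C * t)).le
      simpa using (h.bound t ht j).trans (le_add_of_nonneg_left a1)
    | succ n ih =>
      intro t ht j
      refine image_norm_le_of_norm_deriv_right_le_deriv_boundary (f := fun τ => u τ j)
        (f' := fun τ => u' τ j) (a := 0) (b := 1)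
        (B := fun t => ω j * Real.exp (C * t) + U * ((C * t) ^ (n + 1) / (n + 1).factorial))
        (B' := fun t => ω j * (Real.exp (C * t) * C) + U * (C * ((C * t) ^ n / n.factorial)))
        (fun t ht => (h.hasDeriv t ht j).continuousWithinAt)
        (fun t ht => (h.hasDeriv t (Ico_subset_Icc_self ht) j).mono_of_mem_nhdsWithin
          (Icc_mem_nhdsGE_of_mem ht)) ?_ ?_ ?_ ht
      · simpa using h0 j
      · intro t
        have e1 : HasDerivAt (fun t => C * t) C t := by
          simpa using (hasDerivAt_id t).const_mul C
        have e2 := (e1.pow (n + 1)).div_const ((n + 1).factorial : ℝ)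
        refine (e1.exp.const_mul _).add ((e2.congr_deriv ?_).const_mul U)
        rw [Nat.factorial_succ]
        push_cast
        have : (n.factorial : ℝ) ≠ 0 := by positivity
        field_simp
      · intro t ht
        have ht' := Ico_subset_Icc_self ht
        set X := U * ((C * t) ^ n / n.factorial) with hX
        have hX0 : 0 ≤ X := by
          have := mul_nonneg hC0 ht.1
          positivity
        have hexp := Real.exp_pos (C * t)
        have hle : ∀ m, ω m ≤ R * ω j → ‖u t m‖ ≤ R * ω j * Real.exp (C * t) + X := fun m hm =>
          (ih t ht' m).trans (by gcongr)
        refine (h.norm_deriv_le hL ht' (hle j ?_) (fun l => hle _ (hp j l))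
          (fun l => hle _ (hm j l))).trans ?_
        · exact le_mul_of_one_le_left (hω j) hR
        · have : (4 * d + L) * X ≤ C * X :=
            mul_le_mul_of_nonneg_right (le_mul_of_one_le_right hdL hR) hX0
          have e : U * (C * ((C * t) ^ n / n.factorial)) = C * X := by rw [hX]; ring
          rw [e, mul_add]
          refine add_le_add (le_of_eq ?_) this
          rw [hC]
          ring
  refine ge_of_tendsto' (f := fun n : ℕ =>
    ω j * Real.exp (C * t) + U * ((C * t) ^ n / n.factorial)) (x := Filter.atTop) ?_
    (fun n => key n t ht j)
  have := ((FloorSemiring.tendsto_pow_div_factorial_atTop (C * t)).const_mul U).const_add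
    (ω j * Real.exp (C * t))
  simpa using this

end IsSchrodingerSolution

theorem abs_apply_le_latticeNorm {d : ℕ} (j : Fin d → ℤ) (l : Fin d) :
    |(j l : ℝ)| ≤ latticeNorm j := by
  have := PiLp.norm_apply_le (WithLp.toLp 2 (fun k => (j k : ℝ)) : EuclideanSpace ℝ (Fin d)) l
  simpa [latticeNorm] using this

theorem latticeNorm_nonneg {d : ℕ} (j : Fin d → ℤ) : 0 ≤ latticeNorm j := norm_nonneg _

/-- Superexponential decay absorbs the exponential weight `n ^ (4 |j_l|)`. -/
theorem exp_mul_le_of_decay {d : ℕ} {v : (Fin d → ℤ) → ℂ} {S : ℝ} (hS : 0 ≤ S)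
    (hv : ∀ j, ‖v j‖ ≤ S * Real.exp (-(4 * latticeNorm j * Real.log (latticeNorm j + 1))))
    {n : ℝ} (hn : 1 ≤ n) (j : Fin d → ℤ) (l : Fin d) :
    Real.exp (4 * Real.log n * |(j l : ℝ)|) * ‖v j‖ ≤ S * Real.exp (4 * n * Real.log n) := by
  have hr := abs_apply_le_latticeNorm j l
  set ρ := latticeNorm j with hρ
  have hρ0 : 0 ≤ ρ := latticeNorm_nonneg j
  have hx : 0 ≤ Real.log n := Real.log_nonneg hn
  have hlog : 0 ≤ Real.log (ρ + 1) := Real.log_nonneg (by linarith)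
  have key : 4 * Real.log n * |(j l : ℝ)| - 4 * ρ * Real.log (ρ + 1) ≤ 4 * n * Real.log n := by
    have e1 := mul_le_mul_of_nonneg_left hr hx
    -- For |j| ≥ n the decay dominates the weight; for |j| ≤ n the weight is at most n^{4n}.
    rcases le_total n ρ with hc | hc
    · have e2 : Real.log n ≤ Real.log (ρ + 1) := Real.log_le_log (by linarith) (by linarith)
      have e3 := mul_le_mul_of_nonneg_left e2 hρ0
      have e4 : 0 ≤ n * Real.log n := by positivity
      linarith
    · have e2 := mul_le_mul_of_nonneg_right hc hx
      have e3 : 0 ≤ ρ * Real.log (ρ + 1) := by positivity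
      linarith
  calc Real.exp (4 * Real.log n * |(j l : ℝ)|) * ‖v j‖
      ≤ Real.exp (4 * Real.log n * |(j l : ℝ)|) * (S * Real.exp (-(4 * ρ * Real.log (ρ + 1)))) := by
        gcongr
        exact hv j
    _ = S * Real.exp (4 * Real.log n * |(j l : ℝ)| - 4 * ρ * Real.log (ρ + 1)) := by
        rw [sub_eq_add_neg, Real.exp_add]
        ring
    _ ≤ _ := by gcongr

namespace IsSchrodingerSolution

variable {d : ℕ} {L U : ℝ} {u u' : ℝ → (Fin d → ℤ) → ℂ}

/-- The propagated weight is exponential of rate 4 log n in ± coordinate `l`, so neighbouring values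
differ by a factor of at most n⁴. The resulting loss e^{(4d+L)n⁴} is harmless where |j_l| ≥ n⁴ and
log n is large. -/
theorem norm_le_of_decay (h : IsSchrodingerSolution L U u u') (hL : 0 ≤ L) {S : ℝ} (hS : 0 ≤ S)
    (hv : ∀ j, ‖u 0 j‖ ≤ S * Real.exp (-(4 * latticeNorm j * Real.log (latticeNorm j + 1))))
    {n : ℝ} (hn : 1 ≤ n) {t : ℝ} (ht : t ∈ Icc (0 : ℝ) 1) (j : Fin d → ℤ) (l : Fin d) :
    ‖u t j‖ ≤ S * Real.exp (4 * n * Real.log n - 4 * Real.log n * |(j l : ℝ)|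
      + (4 * d + L) * n ^ 4) := by
  have hx : 0 ≤ Real.log n := Real.log_nonneg hn
  have hn4 : n ^ 4 = Real.exp (4 * Real.log n) := by
    rw [show 4 * Real.log n = ((4 : ℕ) : ℝ) * Real.log n by norm_num, Real.exp_nat_mul,
      Real.exp_log (by linarith)]
  obtain ⟨s, hs1, hs⟩ : ∃ s : ℝ, |s| = 1 ∧ s * (j l : ℝ) = |(j l : ℝ)| := by
    rcases le_total 0 (j l : ℝ) with hc | hc
    · exact ⟨1, by simp, by rw [abs_of_nonneg hc, one_mul]⟩
    · exact ⟨-1, by simp, by rw [abs_of_nonpos hc]; ring⟩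
  have hstep : ∀ (m m' : Fin d → ℤ), |((m' l : ℝ) - m l)| ≤ 1 →
      S * Real.exp (4 * n * Real.log n - 4 * Real.log n * (s * (m' l : ℝ)))
        ≤ n ^ 4 * (S * Real.exp (4 * n * Real.log n - 4 * Real.log n * (s * (m l : ℝ)))) := by
    intro m m' hmm
    rw [hn4, mul_left_comm (Real.exp _) S, ← Real.exp_add]
    have e1 : -(s * ((m' l : ℝ) - m l)) ≤ 1 :=
      (neg_le_abs _).trans (by rw [abs_mul, hs1, one_mul]; exact hmm)
    gcongr
    have := mul_le_mul_of_nonneg_left e1 hx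
    linarith
  have hsing : ∀ i : Fin d, |((Pi.single i (1 : ℤ) : Fin d → ℤ) l : ℝ)| ≤ 1 := fun i => by
    rcases eq_or_ne l i with rfl | hli
    · simp
    · simp [Pi.single_eq_of_ne hli]
  have := h.norm_le_weight hL (R := n ^ 4) (one_le_pow₀ hn)
    (ω := fun m => S * Real.exp (4 * n * Real.log n - 4 * Real.log n * (s * (m l : ℝ))))
    (fun m => by positivity)
    (fun m i => hstep m _ (by simpa using hsing i))
    (fun m i => hstep m _ (by simpa using hsing i))
    (fun m => by
      have e1 := exp_mul_le_of_decay hS hv hn m l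
      have e2 : s * (m l : ℝ) ≤ |(m l : ℝ)| :=
        (le_abs_self _).trans (by rw [abs_mul, hs1, one_mul])
      rw [sub_eq_add_neg, Real.exp_add, ← mul_assoc, Real.exp_neg, ← div_eq_mul_inv,
        le_div_iff₀ (Real.exp_pos _), mul_comm]
      refine le_trans ?_ e1
      gcongr)
    ht j
  refine this.trans ?_
  rw [mul_assoc, ← Real.exp_add, hs]
  have hdL : 0 ≤ (4 * d + L) * n ^ 4 := by positivity
  have := mul_le_of_le_one_right hdL ht.2
  gcongr S * Real.exp ?_
  linarith

end IsSchrodingerSolution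

/-! ### Truncation and the Carleman inequality -/

namespace FinState

/-- Only finitely many scalar coefficients vary in time, so `T` need not be bounded. -/
theorem hasDerivWithinAt_map_cutoff {α : Type*} (T : Module.End ℂ (FinState α)) (Q : Finset α)
    {v v' : ℝ → α → ℂ} {s : Set ℝ} {t : ℝ}
    (hv : ∀ j, HasDerivWithinAt (fun τ => v τ j) (v' t j) s t) :
    HasDerivWithinAt (fun τ => T (cutoff Q (v τ))) (T (cutoff Q (v' t))) s t := by
  have e : ∀ w : α → ℂ, T (cutoff Q w) = ∑ j ∈ Q, w j • T (cutoff {j} 1) := fun w => by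
    rw [cutoff_eq_sum, map_sum]
    simp only [map_smul]
  simp only [e]
  exact HasDerivWithinAt.fun_sum fun j _ => (hv j).smul_const _

theorem norm_cutoff_sq {α : Type*} (Q : Finset α) (v : α → ℂ) :
    ‖cutoff Q v‖ ^ 2 = ∑ j ∈ Q, ‖v j‖ ^ 2 := by
  classical
  rw [norm_sq_eq_sum (s := Q) fun j hj => by rw [cutoff_apply, if_neg hj]]
  exact Finset.sum_congr rfl fun j hj => by rw [cutoff_apply, if_pos hj]

end FinState

open FinState

/-- The commutator of the Laplacian with the sharp cutoff to `Q`. -/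
noncomputable def cutoffCommutator {d : ℕ} (Q : Finset (Fin d → ℤ)) (v : (Fin d → ℤ) → ℂ)
    (j : Fin d → ℤ) : ℂ :=
  (if j ∈ Q then discreteLaplacian v j else 0)
    - discreteLaplacian (fun m => if m ∈ Q then v m else 0) j

/-- Edges with both ends in `Q`, or both outside, cancel. Only edges cut by the boundary remain, at
most `2 * d` per site. -/
theorem norm_cutoffCommutator_le {d : ℕ} (Q : Finset (Fin d → ℤ)) (v : (Fin d → ℤ) → ℂ)
    (j : Fin d → ℤ) {w X : ℝ} (hX : 0 ≤ X) (hw : 0 ≤ w)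
    (h1 : ∀ l, ¬ (j ∈ Q ↔ j + Pi.single l 1 ∈ Q) → w * ‖v (j + Pi.single l 1)‖ ≤ X)
    (h2 : ∀ l, ¬ (j ∈ Q ↔ j - Pi.single l 1 ∈ Q) → w * ‖v (j - Pi.single l 1)‖ ≤ X) :
    w * ‖cutoffCommutator Q v j‖ ≤ 2 * d * X := by
  have hterm : ∀ m, (¬ (j ∈ Q ↔ m ∈ Q) → w * ‖v m‖ ≤ X) →
      w * ‖(if j ∈ Q then v m else 0) - (if m ∈ Q then v m else 0)‖ ≤ X := by
    intro m hm
    by_cases hj : j ∈ Q <;> by_cases hmQ : m ∈ Q <;> simp_all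
  have e : cutoffCommutator Q v j = ∑ l : Fin d,
      (((if j ∈ Q then v (j + Pi.single l 1) else 0)
          - (if j + Pi.single l 1 ∈ Q then v (j + Pi.single l 1) else 0))
        + ((if j ∈ Q then v (j - Pi.single l 1) else 0)
          - (if j - Pi.single l 1 ∈ Q then v (j - Pi.single l 1) else 0))) := by
    by_cases hj : j ∈ Q <;>
    simp only [cutoffCommutator, discreteLaplacian, hj, if_true, if_false, ← Finset.sum_sub_distrib,
      zero_sub, ← Finset.sum_neg_distrib] <;>
    exact Finset.sum_congr rfl fun l _ => by ring
  rw [e]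
  calc w * ‖_‖ ≤ w * ∑ l : Fin d, _ := by gcongr; exact norm_sum_le _ _
    _ ≤ ∑ l : Fin d, 2 * X := by
      rw [Finset.mul_sum]
      refine Finset.sum_le_sum fun l _ => ?_
      have a1 := hterm _ (h1 l)
      have a2 := hterm _ (h2 l)
      have a3 := mul_le_mul_of_nonneg_left (norm_add_le
        ((if j ∈ Q then v (j + Pi.single l 1) else 0)
          - (if j + Pi.single l 1 ∈ Q then v (j + Pi.single l 1) else 0))
        ((if j ∈ Q then v (j - Pi.single l 1) else 0)
          - (if j - Pi.single l 1 ∈ Q then v (j - Pi.single l 1) else 0))) hw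
      linarith
    _ = 2 * d * X := by simp; ring

/-- The convex spatial weight `a x + κ x² / 2` in the direction `k`. -/
noncomputable def spatialWeight {d : ℕ} (a κ : ℝ) (k : Fin d) (j : Fin d → ℤ) : ℝ :=
  a * j k + κ * (j k : ℝ) ^ 2 / 2

/-- The weighted and truncated solution `exp (-β (t - t₀)²) exp (W) 1_Q u(t)`. -/
noncomputable def weightedState {d : ℕ} (a κ β t₀ : ℝ) (k : Fin d) (Q : Finset (Fin d → ℤ))
    (u : ℝ → (Fin d → ℤ) → ℂ) (t : ℝ) : FinState (Fin d → ℤ) :=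
  cutoff Q fun j => (Real.exp (-β * (t - t₀) ^ 2) : ℂ) * Real.exp (spatialWeight a κ k j) * u t j

/-- The quadratic functional whose time derivative controls the weighted state. -/
noncomputable def virial {d : ℕ} (a κ β t₀ : ℝ) (k : Fin d) (Q : Finset (Fin d → ℤ))
    (u : ℝ → (Fin d → ℤ) → ℂ) (t : ℝ) : ℝ :=
  (⟪weightedState a κ β t₀ k Q u t,
    Complex.I • conjLaplacian a κ k (weightedState a κ β t₀ k Q u t)⟫_ℂ).re
    + (-2 * β * (t - t₀)) * ‖weightedState a κ β t₀ k Q u t‖ ^ 2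

section Carleman

variable {d : ℕ} {L U : ℝ} {u u' : ℝ → (Fin d → ℤ) → ℂ}

theorem conjLaplacian_weightedState (a κ β t₀ : ℝ) (k : Fin d) (Q : Finset (Fin d → ℤ))
    (u : ℝ → (Fin d → ℤ) → ℂ) (t : ℝ) (j : Fin d → ℤ) :
    conjLaplacian a κ k (weightedState a κ β t₀ k Q u t) j
      = (Real.exp (-β * (t - t₀) ^ 2) : ℂ) * Real.exp (spatialWeight a κ k j)
        * discreteLaplacian (fun m => if m ∈ Q then u t m else 0) j := by
  refine conjLaplacian_apply a κ k _ j _ _ fun m => ?_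
  rw [weightedState, cutoff_apply, spatialWeight]
  split_ifs <;> simp

/-- The commutator pays for the time weight (2β) and for the potential (L²), and one ‖g‖² is kept.
What remains is the truncation error, which lives on `Q'`, a set containing `Q` and its neighbours.
-/
theorem virial_hasDerivWithinAt (h : IsSchrodingerSolution L U u u')
    {a κ β t₀ G X : ℝ} (hκ : 0 ≤ κ) (hβ : 0 ≤ β) (hX : 0 ≤ X) (k : Fin d)
    {Q Q' : Finset (Fin d → ℤ)} (hQ : Q ⊆ Q')
    (hQp : ∀ j ∈ Q, ∀ l, j + Pi.single l 1 ∈ Q') (hQm : ∀ j ∈ Q, ∀ l, j - Pi.single l 1 ∈ Q')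
    (hG : ∀ j ∈ Q, G ≤ commDiag a κ k j)
    (hGβ : 2 * β + L ^ 2 + 1 ≤ (G - 2 * (Real.exp κ - Real.exp (-κ))) / 2)
    (hXp : ∀ t ∈ Icc (0 : ℝ) 1, ∀ j l, ¬ (j ∈ Q ↔ j + Pi.single l 1 ∈ Q) →
      Real.exp (spatialWeight a κ k j) * ‖u t (j + Pi.single l 1)‖ ≤ X)
    (hXm : ∀ t ∈ Icc (0 : ℝ) 1, ∀ j l, ¬ (j ∈ Q ↔ j - Pi.single l 1 ∈ Q) →
      Real.exp (spatialWeight a κ k j) * ‖u t (j - Pi.single l 1)‖ ≤ X)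
    {t : ℝ} (ht : t ∈ Icc (0 : ℝ) 1) :
    ∃ D, HasDerivWithinAt (virial a κ β t₀ k Q u) D (Icc 0 1) t ∧
      ‖weightedState a κ β t₀ k Q u t‖ ^ 2 - Q'.card * (2 * d * X) ^ 2 ≤ D := by
  set g := weightedState a κ β t₀ k Q u with hg_def
  set E : ℝ := Real.exp (-β * (t - t₀) ^ 2) with hE
  have hE1 : E ≤ 1 := Real.exp_le_one_iff.2 (by nlinarith [sq_nonneg (t - t₀)])
  have hE0 : 0 < E := Real.exp_pos _
  set W := spatialWeight a κ k with hW
  set v' : ℝ → (Fin d → ℤ) → ℂ := fun τ j =>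
    ((-2 * β * (τ - t₀) : ℝ) : ℂ) * (Real.exp (-β * (τ - t₀) ^ 2) * Real.exp (W j) * u τ j)
      + Real.exp (-β * (τ - t₀) ^ 2) * Real.exp (W j) * u' τ j with hv'
  have hder : ∀ j, HasDerivWithinAt
      (fun τ => (Real.exp (-β * (τ - t₀) ^ 2) : ℂ) * Real.exp (W j) * u τ j) (v' t j)
      (Icc 0 1) t := by
    intro j
    have e1 : HasDerivAt (fun τ : ℝ => -β * (τ - t₀) ^ 2) (-2 * β * (t - t₀)) t := by
      have := (((hasDerivAt_id t).sub_const t₀).pow 2).const_mul (-β)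
      refine this.congr_deriv ?_
      simp
      ring
    have e2 := ((e1.exp.ofReal_comp.hasDerivWithinAt (s := Icc 0 1)).mul_const
      (Real.exp (W j) : ℂ)).mul (h.hasDeriv t ht j)
    refine e2.congr_deriv ?_
    simp only [hv']
    push_cast
    ring
  -- The forcing splits into the defect of the equation, `F1`, and the cutoff error, `F2`.
  set F1 : FinState (Fin d → ℤ) := cutoff Q fun j =>
    -Complex.I * (E * Real.exp (W j)) * (Complex.I * u' t j + discreteLaplacian (u t) j) with hF1
  set F2 : FinState (Fin d → ℤ) := cutoff Q' fun j =>
    Complex.I * (E * Real.exp (W j)) * cutoffCommutator Q (u t) j with hF2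
  have hgt : ∀ j, g t j = if j ∈ Q then (E : ℂ) * Real.exp (W j) * u t j else 0 := fun j => by
    rw [hg_def, weightedState, cutoff_apply]
  have hsplit : cutoff Q (v' t) = Complex.I • conjLaplacian a κ k (g t)
      + ((-2 * β * (t - t₀) : ℝ) : ℂ) • g t + (F1 + F2) := by
    ext j
    simp only [add_apply, smul_apply, hg_def, conjLaplacian_weightedState]
    rw [← hg_def, hgt]
    simp only [hF1, hF2, cutoff_apply, cutoffCommutator]
    rw [← hE, ← hW]
    by_cases hj : j ∈ Q
    · rw [if_pos hj, if_pos hj, if_pos hj, if_pos (hQ hj), if_pos hj]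
      simp only [hv', ← hE]
      linear_combination ((E : ℂ) * Real.exp (W j) * u' t j) * Complex.I_mul_I
    · rw [if_neg hj, if_neg hj, if_neg hj, if_neg hj]
      by_cases hj' : j ∈ Q'
      · rw [if_pos hj']
        ring
      · rw [if_neg hj']
        have : discreteLaplacian (fun m => if m ∈ Q then u t m else 0) j = 0 := by
          refine Finset.sum_eq_zero fun l _ => ?_
          have n1 : j + Pi.single l 1 ∉ Q := fun hc => hj' (by simpa using hQm _ hc l)
          have n2 : j - Pi.single l 1 ∉ Q := fun hc => hj' (by simpa using hQp _ hc l)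
          simp [n1, n2, hj]
        rw [this]
        simp
  obtain ⟨D, hD, hDle⟩ := virial_deriv (conjLaplacian a κ k) (conjLaplacianAdj a κ k)
    (inner_conjLaplacian a κ k) (g := g) (b := fun τ => -2 * β * (τ - t₀)) (b2 := -2 * β)
    (hasDerivWithinAt_map_cutoff 1 Q hder) (hasDerivWithinAt_map_cutoff _ Q hder)
    (by simpa using (((hasDerivAt_id t).sub_const t₀).const_mul (-2 * β)).hasDerivWithinAt) hsplit
  refine ⟨D, hD, le_trans ?_ hDle⟩
  have c1 := commutator_lower_bound a κ hκ k (G := G) (g t) fun j hj => hG j (by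
    by_contra hc
    exact hj (by rw [hgt, if_neg hc]))
  have hnW : ∀ j, ‖(E : ℂ) * Real.exp (W j)‖ = E * Real.exp (W j) := fun j => by
    rw [← Complex.ofReal_mul, Complex.norm_of_nonneg (by positivity)]
  have c2 : ‖F1‖ ^ 2 ≤ L ^ 2 * ‖g t‖ ^ 2 := by
    rw [hF1, hg_def, weightedState, norm_cutoff_sq, norm_cutoff_sq, Finset.mul_sum]
    refine Finset.sum_le_sum fun j _ => ?_
    rw [← mul_pow]
    refine pow_le_pow_left₀ (norm_nonneg _) ?_ 2
    rw [norm_mul, norm_mul, norm_neg, Complex.norm_I, one_mul, ← hE, norm_mul _ (u t j), ← hW,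
      hnW, mul_left_comm]
    exact mul_le_mul_of_nonneg_left (h.ineq t ht j) (by positivity)
  have c3 : ‖F2‖ ^ 2 ≤ Q'.card * (2 * d * X) ^ 2 := by
    rw [hF2, norm_cutoff_sq, ← nsmul_eq_mul]
    refine Finset.sum_le_card_nsmul _ _ _ fun j _ => ?_
    refine pow_le_pow_left₀ (norm_nonneg _) ?_ 2
    rw [norm_mul, norm_mul, Complex.norm_I, one_mul, hnW, mul_assoc]
    have e1 := norm_cutoffCommutator_le Q (u t) j hX (Real.exp_pos (W j)).le
      (hXp t ht j) (hXm t ht j)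
    have e2 : 0 ≤ Real.exp (W j) * ‖cutoffCommutator Q (u t) j‖ := by positivity
    exact (mul_le_of_le_one_left e2 hE1).trans e1
  have c4 : ‖F1 + F2‖ ^ 2 ≤ 2 * ‖F1‖ ^ 2 + 2 * ‖F2‖ ^ 2 := by
    have := norm_add_le F1 F2
    nlinarith [sq_nonneg (‖F1‖ - ‖F2‖), norm_nonneg (F1 + F2)]
  have c5 := mul_le_mul_of_nonneg_right hGβ (sq_nonneg ‖g t‖)
  linarith

/-- The Laplacian contributes `4 * d` and the scalar |b| ≤ 2β the rest. Neighbours of `Q` enter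
because the Laplacian reads them. -/
theorem abs_virial_le {a κ β t₀ Z : ℝ} (hβ : 0 ≤ β) (k : Fin d) {Q : Finset (Fin d → ℤ)} {t : ℝ}
    (ht : |t - t₀| ≤ 1) (hZ : 0 ≤ Z)
    (hZ0 : ∀ j ∈ Q, Real.exp (spatialWeight a κ k j) * ‖u t j‖ ≤ Z)
    (hZp : ∀ j ∈ Q, ∀ l, Real.exp (spatialWeight a κ k j) * ‖u t (j + Pi.single l 1)‖ ≤ Z)
    (hZm : ∀ j ∈ Q, ∀ l, Real.exp (spatialWeight a κ k j) * ‖u t (j - Pi.single l 1)‖ ≤ Z) :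
    |virial a κ β t₀ k Q u t|
      ≤ Real.exp (-2 * β * (t - t₀) ^ 2) * (Q.card * ((4 * d + 2 * β) * Z ^ 2)) := by
  set g := weightedState a κ β t₀ k Q u t with hg
  set E : ℝ := Real.exp (-β * (t - t₀) ^ 2) with hE
  have hE0 : 0 < E := Real.exp_pos _
  have hE2 : Real.exp (-2 * β * (t - t₀) ^ 2) = E ^ 2 := by
    rw [hE, ← Real.exp_nat_mul]
    congr 1
    push_cast
    ring
  have hnW : ∀ j, ‖(E : ℂ) * Real.exp (spatialWeight a κ k j)‖
      = E * Real.exp (spatialWeight a κ k j) := fun j => by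
    rw [← Complex.ofReal_mul, Complex.norm_of_nonneg (by positivity)]
  have hgj : ∀ j ∈ Q, ‖g j‖ ≤ E * Z := fun j hj => by
    rw [hg, weightedState, cutoff_apply, if_pos hj, norm_mul, ← hE, hnW, mul_assoc]
    exact mul_le_mul_of_nonneg_left (hZ0 j hj) hE0.le
  have hgz : ∀ j ∉ Q, g j = 0 := fun j hj => by
    rw [hg, weightedState, cutoff_apply, if_neg hj]
  have hMg : ∀ j ∈ Q, ‖conjLaplacian a κ k g j‖ ≤ 4 * d * (E * Z) := fun j hj => by
    set w := Real.exp (spatialWeight a κ k j) with hw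
    have hw0 : 0 < w := Real.exp_pos _
    have e : ∀ m, w * ‖u t m‖ ≤ Z → ‖if m ∈ Q then u t m else 0‖ ≤ Z / w := fun m hm => by
      rw [le_div_iff₀ hw0, mul_comm]
      split_ifs
      · exact hm
      · simpa using hZ
    have := norm_discreteLaplacian_le (v := fun m => if m ∈ Q then u t m else 0)
      (e j (hZ0 j hj)) (fun l => e _ (hZp j hj l)) (fun l => e _ (hZm j hj l))
    rw [hg, conjLaplacian_weightedState, norm_mul, ← hE, hnW]
    calc E * w * _ ≤ E * w * (4 * d * (Z / w)) := by gcongr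
      _ = _ := by field_simp
  have b1 : |(⟪g, Complex.I • conjLaplacian a κ k g⟫_ℂ).re|
      ≤ Q.card * (E * Z * (4 * d * (E * Z))) := by
    refine (Complex.abs_re_le_norm _).trans ?_
    rw [inner_smul_right, norm_mul, Complex.norm_I, one_mul, inner_eq_sum hgz, ← nsmul_eq_mul]
    refine (norm_sum_le _ _).trans (Finset.sum_le_card_nsmul _ _ _ fun j hj => ?_)
    rw [norm_mul, RCLike.norm_conj]
    exact mul_le_mul (hgj j hj) (hMg j hj) (norm_nonneg _) (by positivity)
  have b2 : ‖g‖ ^ 2 ≤ Q.card * (E * Z) ^ 2 := by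
    rw [norm_sq_eq_sum hgz, ← nsmul_eq_mul]
    exact Finset.sum_le_card_nsmul _ _ _ fun j hj =>
      pow_le_pow_left₀ (norm_nonneg _) (hgj j hj) 2
  have b3 : |(-2 * β * (t - t₀)) * ‖g‖ ^ 2| ≤ 2 * β * (Q.card * (E * Z) ^ 2) := by
    rw [abs_mul, abs_of_nonneg (sq_nonneg ‖g‖), abs_mul, abs_mul, abs_of_nonneg hβ, abs_neg,
      abs_of_pos (zero_lt_two' ℝ)]
    exact mul_le_mul (mul_le_of_le_one_right (by positivity) ht) b2 (sq_nonneg _) (by positivity)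
  rw [hE2]
  refine (abs_add_le _ _).trans ((add_le_add b1 b3).trans (le_of_eq ?_))
  ring

/-- A lower bound for the increment of a function from lower bounds for its derivative. -/
theorem le_sub_of_hasDerivWithinAt {f f' : ℝ → ℝ} {s₁ s₂ m e : ℝ} (h1 : 0 ≤ s₁) (h12 : s₁ ≤ s₂)
    (h2 : s₂ ≤ 1) (hf : ∀ t ∈ Icc (0 : ℝ) 1, HasDerivWithinAt f (f' t) (Icc 0 1) t)
    (he : ∀ t ∈ Icc (0 : ℝ) 1, -e ≤ f' t) (hm : ∀ t ∈ Icc s₁ s₂, m - e ≤ f' t) :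
    m * (s₂ - s₁) - e ≤ f 1 - f 0 := by
  have key : ∀ x y C : ℝ, 0 ≤ x → x ≤ y → y ≤ 1 → (∀ t ∈ Icc x y, C ≤ f' t) →
      C * (y - x) ≤ f y - f x := by
    intro x y C hx hxy hy hC
    have hsub : Icc x y ⊆ Icc 0 1 := Icc_subset_Icc hx hy
    have hd : ∀ t ∈ interior (Icc x y), HasDerivAt f (f' t) t := by
      intro t ht
      rw [interior_Icc] at ht
      exact (hf t (hsub (Ioo_subset_Icc_self ht))).hasDerivAt
        (Icc_mem_nhds (hx.trans_lt ht.1) (ht.2.trans_le hy))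
    refine Convex.mul_sub_le_image_sub_of_le_deriv (convex_Icc x y)
      (fun t ht => ((hf t (hsub ht)).mono hsub).continuousWithinAt)
      (fun t ht => (hd t ht).differentiableAt.differentiableWithinAt) (fun t ht => ?_)
      x (left_mem_Icc.2 hxy) y (right_mem_Icc.2 hxy) hxy
    rw [(hd t ht).deriv]
    exact hC t (interior_subset ht)
  have a1 := key 0 s₁ (-e) le_rfl h1 (h12.trans h2) fun t ht => he t ⟨ht.1, by linarith [ht.2]⟩
  have a2 := key s₁ s₂ (m - e) h1 h12 h2 hm
  have a3 := key s₂ 1 (-e) (h1.trans h12) h2 le_rfl fun t ht => he t ⟨by linarith [ht.1], ht.2⟩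
  linarith

/-- Integrate the virial derivative over [0,1]: the mass at `j₀` during |t - t₀| ≤ δ is bounded by
the truncation error plus the two endpoint values, which carry the Gaussian factor at distance at
least `c`. -/
theorem carleman_inequality (h : IsSchrodingerSolution L U u u')
    {a κ β t₀ G X Z c δ ε : ℝ} (hκ : 0 ≤ κ) (hβ : 0 ≤ β) (hX : 0 ≤ X) (hZ : 0 ≤ Z) (k : Fin d)
    {Q Q' : Finset (Fin d → ℤ)} (hQ : Q ⊆ Q')
    (hQp : ∀ j ∈ Q, ∀ l, j + Pi.single l 1 ∈ Q') (hQm : ∀ j ∈ Q, ∀ l, j - Pi.single l 1 ∈ Q')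
    (hG : ∀ j ∈ Q, G ≤ commDiag a κ k j)
    (hGβ : 2 * β + L ^ 2 + 1 ≤ (G - 2 * (Real.exp κ - Real.exp (-κ))) / 2)
    (hXp : ∀ t ∈ Icc (0 : ℝ) 1, ∀ j l, ¬ (j ∈ Q ↔ j + Pi.single l 1 ∈ Q) →
      Real.exp (spatialWeight a κ k j) * ‖u t (j + Pi.single l 1)‖ ≤ X)
    (hXm : ∀ t ∈ Icc (0 : ℝ) 1, ∀ j l, ¬ (j ∈ Q ↔ j - Pi.single l 1 ∈ Q) →
      Real.exp (spatialWeight a κ k j) * ‖u t (j - Pi.single l 1)‖ ≤ X)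
    (hZ0 : ∀ t ∈ ({0, 1} : Set ℝ), ∀ j ∈ Q, Real.exp (spatialWeight a κ k j) * ‖u t j‖ ≤ Z)
    (hZp : ∀ t ∈ ({0, 1} : Set ℝ), ∀ j ∈ Q, ∀ l,
      Real.exp (spatialWeight a κ k j) * ‖u t (j + Pi.single l 1)‖ ≤ Z)
    (hZm : ∀ t ∈ ({0, 1} : Set ℝ), ∀ j ∈ Q, ∀ l,
      Real.exp (spatialWeight a κ k j) * ‖u t (j - Pi.single l 1)‖ ≤ Z)
    (hc0 : 0 ≤ c) (hct : c ≤ t₀) (hct' : c ≤ 1 - t₀) (hδ : 0 ≤ δ) (hδc : δ ≤ c) (hε : 0 ≤ ε)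
    {j₀ : Fin d → ℤ} (hj₀ : j₀ ∈ Q) (hu : ∀ t ∈ Icc (t₀ - δ) (t₀ + δ), ε ≤ ‖u t j₀‖) :
    (Real.exp (-β * δ ^ 2) * Real.exp (spatialWeight a κ k j₀) * ε) ^ 2 * (2 * δ)
      ≤ Q'.card * (2 * d * X) ^ 2
        + 2 * (Real.exp (-2 * β * c ^ 2) * (Q.card * ((4 * d + 2 * β) * Z ^ 2))) := by
  have hD := fun t (ht : t ∈ Icc (0 : ℝ) 1) =>
    virial_hasDerivWithinAt h hκ hβ hX k hQ hQp hQm hG hGβ hXp hXm (t₀ := t₀) ht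
  choose! D hD1 hD2 using hD
  have hinc := le_sub_of_hasDerivWithinAt (s₁ := t₀ - δ) (s₂ := t₀ + δ) (by linarith)
    (by linarith) (by linarith) hD1 (e := Q'.card * (2 * d * X) ^ 2)
    (fun t ht => by linarith [hD2 t ht, sq_nonneg ‖weightedState a κ β t₀ k Q u t‖])
    (m := (Real.exp (-β * δ ^ 2) * Real.exp (spatialWeight a κ k j₀) * ε) ^ 2)
    (fun t ht => by
      refine le_trans ?_ (hD2 t ⟨by linarith [ht.1], by linarith [ht.2]⟩)
      refine sub_le_sub_right (le_trans ?_ (norm_apply_sq_le _ j₀)) _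
      refine pow_le_pow_left₀ (by positivity) ?_ 2
      rw [weightedState, cutoff_apply, if_pos hj₀, norm_mul, ← Complex.ofReal_mul,
        Complex.norm_of_nonneg (by positivity)]
      have hts : (t - t₀) ^ 2 ≤ δ ^ 2 :=
        sq_le_sq' (by linarith [ht.1]) (by linarith [ht.2])
      have : -β * δ ^ 2 ≤ -β * (t - t₀) ^ 2 := by nlinarith
      gcongr
      exact hu t ht)
  rw [show t₀ + δ - (t₀ - δ) = 2 * δ by ring] at hinc
  have hend : ∀ t ∈ ({0, 1} : Set ℝ), |virial a κ β t₀ k Q u t|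
      ≤ Real.exp (-2 * β * c ^ 2) * (Q.card * ((4 * d + 2 * β) * Z ^ 2)) := by
    intro t ht
    have h1 : |t - t₀| ≤ 1 ∧ c ^ 2 ≤ (t - t₀) ^ 2 := by
      rcases ht with rfl | rfl
      · exact ⟨abs_le.2 ⟨by linarith, by linarith⟩, by nlinarith⟩
      · exact ⟨abs_le.2 ⟨by linarith, by linarith⟩, by nlinarith⟩
    refine (abs_virial_le hβ k h1.1 hZ (hZ0 t ht) (hZp t ht) (hZm t ht)).trans ?_
    have : -2 * β * (t - t₀) ^ 2 ≤ -2 * β * c ^ 2 := by nlinarith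
    gcongr
  have e0 := (abs_le.1 (hend 0 (by simp))).1
  have e1 := (abs_le.1 (hend 1 (by simp))).2
  linarith

end Carleman

/-! ### Lattice cubes and the choice of parameters -/

open FinState Filter Topology

/-- The lattice cube `|j_l| ≤ N`. -/
noncomputable def latticeCube (d N : ℕ) : Finset (Fin d → ℤ) :=
  Fintype.piFinset fun _ => Finset.Icc (-(N : ℤ)) N

theorem mem_latticeCube {d N : ℕ} {j : Fin d → ℤ} : j ∈ latticeCube d N ↔ ∀ l, |j l| ≤ N := by
  simp [latticeCube, abs_le]

theorem card_latticeCube (d N : ℕ) : (latticeCube d N).card = (2 * N + 1) ^ d := by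
  have : ((N : ℤ) + 1 + N).toNat = 2 * N + 1 := by omega
  simp [latticeCube, this]

/-- Nearest neighbours differ by at most one in every coordinate. -/
theorem abs_add_single_sub_le {d : ℕ} (j : Fin d → ℤ) (l i : Fin d) :
    |(j + Pi.single l 1 : Fin d → ℤ) i - j i| ≤ 1 := by
  rcases eq_or_ne i l with rfl | h
  · simp
  · simp [Pi.single_eq_of_ne h]

theorem abs_sub_single_sub_le {d : ℕ} (j : Fin d → ℤ) (l i : Fin d) :
    |(j - Pi.single l 1 : Fin d → ℤ) i - j i| ≤ 1 := by
  rcases eq_or_ne i l with rfl | h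
  · simp
  · simp [Pi.single_eq_of_ne h]

theorem mem_latticeCube_succ {d N : ℕ} {j m : Fin d → ℤ} (hj : j ∈ latticeCube d N)
    (hm : ∀ i, |m i - j i| ≤ 1) : m ∈ latticeCube d (N + 1) := by
  rw [mem_latticeCube] at *
  intro l
  have := abs_add_le (m l - j l) (j l)
  rw [sub_add_cancel] at this
  push_cast
  linarith [hj l, hm l]

/-- If exactly one of two neighbours lies in the cube, the second one is close to its boundary. -/
theorem exists_le_abs_of_boundary {d N : ℕ} {j m : Fin d → ℤ} (hm : ∀ i, |m i - j i| ≤ 1)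
    (h : ¬ (j ∈ latticeCube d N ↔ m ∈ latticeCube d N)) :
    (∀ i, |j i| ≤ (N : ℤ) + 1) ∧ ∃ i, (N : ℤ) ≤ |m i| := by
  have tri : ∀ i, |j i| ≤ |m i| + 1 ∧ |m i| ≤ |j i| + 1 := fun i => by
    have h1 := abs_sub_abs_le_abs_sub (m i) (j i)
    have h2 := abs_sub_abs_le_abs_sub (j i) (m i)
    rw [abs_sub_comm] at h2
    constructor <;> linarith [hm i]
  by_cases hj : j ∈ latticeCube d N
  · have hmQ : m ∉ latticeCube d N := fun hc => h (iff_of_true hj hc)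
    rw [mem_latticeCube] at hj hmQ
    push Not at hmQ
    obtain ⟨i, hi⟩ := hmQ
    exact ⟨fun i => by linarith [hj i], i, hi.le⟩
  · have hmQ : m ∈ latticeCube d N := by
      by_contra hc
      exact h (iff_of_false hj hc)
    rw [mem_latticeCube] at hj hmQ
    push Not at hj
    obtain ⟨i, hi⟩ := hj
    exact ⟨fun i => by linarith [hmQ i, (tri i).1], i, by have := (tri i).1; omega⟩

/-- Convexity gives e^{2κ} - 1 ≥ 2κ, and the two inverse exponentials add a nonnegative amount. The
bound `hM` keeps the quadratic correction to the exponent above -4. -/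
theorem le_commDiag {d : ℕ} {a κ M : ℝ} (hκ : 0 ≤ κ) (hM : κ * (M + 1 / 2) ≤ 2) (k : Fin d)
    {j : Fin d → ℤ} (hj : |(j k : ℝ)| ≤ M) : 2 * κ * Real.exp (2 * a - 4) ≤ commDiag a κ k j := by
  have e1 : Real.exp (-(2 * (a + κ * ((j k : ℝ) + 1 / 2))))
      ≤ Real.exp (-(2 * (a + κ * ((j k : ℝ) - 1 / 2)))) := Real.exp_le_exp.2 (by linarith)
  have e2 : Real.exp (2 * (a + κ * ((j k : ℝ) + 1 / 2)))
      = Real.exp (2 * (a + κ * ((j k : ℝ) - 1 / 2))) * Real.exp (2 * κ) := by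
    rw [← Real.exp_add]
    ring_nf
  have e3 : Real.exp (2 * a - 4) ≤ Real.exp (2 * (a + κ * ((j k : ℝ) - 1 / 2))) := by
    refine Real.exp_le_exp.2 ?_
    have := mul_le_mul_of_nonneg_left (show -(M + 1 / 2) ≤ (j k : ℝ) - 1 / 2 by
      linarith [(abs_le.1 hj).1]) hκ
    linarith
  have e4 : 2 * κ ≤ Real.exp (2 * κ) - 1 := by linarith [Real.add_one_le_exp (2 * κ)]
  have e5 := mul_le_mul e4 e3 (Real.exp_pos _).le (by linarith)
  rw [commDiag, e2]
  linarith

theorem spatialWeight_le {d : ℕ} {a κ M : ℝ} (ha : 0 ≤ a) (hκ : 0 ≤ κ) (k : Fin d)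
    {j : Fin d → ℤ} (hj : |(j k : ℝ)| ≤ M) :
    spatialWeight a κ k j ≤ (a + κ * M / 2) * |(j k : ℝ)| := by
  have h1 := mul_le_mul_of_nonneg_left (le_abs_self (j k : ℝ)) ha
  have h2 := mul_le_mul_of_nonneg_left
    (mul_le_mul_of_nonneg_right hj (abs_nonneg (j k : ℝ))) hκ
  rw [spatialWeight, ← sq_abs]
  linarith

theorem neg_le_spatialWeight {d : ℕ} {a κ : ℝ} (ha : 0 ≤ a) (hκ : 0 ≤ κ) (k : Fin d)
    (j : Fin d → ℤ) : -(a * |(j k : ℝ)|) ≤ spatialWeight a κ k j := by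
  have h1 := mul_le_mul_of_nonneg_left (neg_abs_le (j k : ℝ)) ha
  have h2 := mul_nonneg hκ (sq_nonneg (j k : ℝ))
  rw [spatialWeight]
  linarith

section Uniqueness

variable {d : ℕ} {L U S : ℝ} {u u' : ℝ → (Fin d → ℤ) → ℂ}

/-- The Carleman inequality with the weight slope `3 log n` on the cube of side `n ^ 4`. -/
theorem carleman_inequality_scaled (h : IsSchrodingerSolution L U u u') (hL : 0 ≤ L) (hS : 0 ≤ S)
    (h0 : ∀ j, ‖u 0 j‖ ≤ S * Real.exp (-(4 * latticeNorm j * Real.log (latticeNorm j + 1))))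
    (h1 : ∀ j, ‖u 1 j‖ ≤ S * Real.exp (-(4 * latticeNorm j * Real.log (latticeNorm j + 1))))
    {t₀ c δ ε : ℝ} (hc0 : 0 ≤ c) (hct : c ≤ t₀) (hct' : c ≤ 1 - t₀) (hδ : 0 ≤ δ) (hδc : δ ≤ c)
    (hε : 0 ≤ ε) (k : Fin d) {j₀ : Fin d → ℤ}
    (hu : ∀ t ∈ Icc (t₀ - δ) (t₀ + δ), ε ≤ ‖u t j₀‖) {n : ℕ} (hn : 2 ≤ n)
    (hj₀ : j₀ ∈ latticeCube d (n ^ 4)) (hnL : 2 * (L ^ 2 + 4) ≤ Real.exp (-4) * n ^ 2) :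
    (Real.exp (-(Real.exp (-4) / 4 * n ^ 2) * δ ^ 2) * (n ^ (3 * (j₀ k).natAbs) : ℝ)⁻¹ * ε) ^ 2
        * (2 * δ)
      ≤ (2 * (n : ℝ) ^ 4 + 3) ^ d * (2 * d * (S * Real.exp (-(Real.log n * n ^ 4)
          + (4 * d + L + 2) * n ^ 4 + 4 * n * Real.log n + 3 * Real.log n))) ^ 2
        + 2 * (Real.exp (-2 * (Real.exp (-4) / 4 * n ^ 2) * c ^ 2) * ((2 * (n : ℝ) ^ 4 + 1) ^ d
          * ((4 * d + 2 * (Real.exp (-4) / 4 * n ^ 2))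
            * (S * Real.exp (4 * n * Real.log n + 4 * Real.log n)) ^ 2))) := by
  have hn2 : (2 : ℝ) ≤ n := by exact_mod_cast hn
  have hn1 : (1 : ℝ) ≤ n := by linarith
  have hn0 : (0 : ℝ) < n := by linarith
  set x := Real.log n with hx
  have hx2 : 1 / 2 ≤ x := by
    have := Real.log_le_log (by norm_num) hn2
    linarith [Real.log_two_gt_d9]
  have hx0 : 0 ≤ x := by linarith
  have hN1 : (1 : ℝ) ≤ (n : ℝ) ^ 4 := one_le_pow₀ hn1
  have hN0 : (0 : ℝ) < (n : ℝ) ^ 4 := by linarith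
  -- κ x stays bounded on the cube, yet 2κ e^{6 log n - 4} = 2e⁻⁴n² is large.
  set κ : ℝ := 1 / (n : ℝ) ^ 4 with hκ
  have hκ0 : 0 ≤ κ := by positivity
  have hκ1 : κ ≤ 1 := (div_le_one hN0).2 hN1
  have hκN : κ * (n : ℝ) ^ 4 = 1 := by rw [hκ]; field_simp
  have hexp6 : Real.exp (2 * (3 * x)) = (n : ℝ) ^ 6 := by
    rw [show 2 * (3 * x) = ((6 : ℕ) : ℝ) * x by push_cast; ring, Real.exp_nat_mul,
      Real.exp_log hn0]
  -- Weight slope 3 against decay rate 4 at distance n⁴ leaves the gain -x n⁴. The `+ 2` in the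
  -- exponent absorbs n⁴ + 1.
  have hX : ∀ t ∈ Icc (0 : ℝ) 1, ∀ j m : Fin d → ℤ, (∀ i, |m i - j i| ≤ 1) →
      ¬ (j ∈ latticeCube d (n ^ 4) ↔ m ∈ latticeCube d (n ^ 4)) →
      Real.exp (spatialWeight (3 * x) κ k j) * ‖u t m‖ ≤ S * Real.exp (-(x * n ^ 4)
          + (4 * d + L + 2) * n ^ 4 + 4 * n * x + 3 * x) := by
    intro t ht j m hm hjm
    obtain ⟨hj, i, hi⟩ := exists_le_abs_of_boundary hm hjm
    have hjk : |(j k : ℝ)| ≤ (n : ℝ) ^ 4 + 1 := by exact_mod_cast hj k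
    have hmi : (n : ℝ) ^ 4 ≤ |(m i : ℝ)| := by exact_mod_cast hi
    have w1 := spatialWeight_le (a := 3 * x) (by linarith) hκ0 k hjk
    have w2 : (3 * x + κ * ((n : ℝ) ^ 4 + 1) / 2) * |(j k : ℝ)|
        ≤ (3 * x + 1) * ((n : ℝ) ^ 4 + 1) := by
      refine mul_le_mul ?_ hjk (abs_nonneg _) (by linarith)
      rw [mul_add, hκN]
      linarith
    have w3 := h.norm_le_of_decay hL hS h0 hn1 ht m i
    have w4 := mul_le_mul_of_nonneg_left hmi hx0
    calc Real.exp (spatialWeight (3 * x) κ k j) * ‖u t m‖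
        ≤ Real.exp ((3 * x + 1) * ((n : ℝ) ^ 4 + 1)) * (S * Real.exp (4 * n * x
            - 4 * x * (n : ℝ) ^ 4 + (4 * d + L) * n ^ 4)) := by
          refine mul_le_mul (Real.exp_le_exp.2 (w1.trans w2)) (w3.trans ?_) (norm_nonneg _)
            (Real.exp_pos _).le
          gcongr S * Real.exp ?_
          linarith
      _ = S * Real.exp ((3 * x + 1) * ((n : ℝ) ^ 4 + 1) + (4 * n * x
            - 4 * x * (n : ℝ) ^ 4 + (4 * d + L) * n ^ 4)) := by
          rw [Real.exp_add ((3 * x + 1) * ((n : ℝ) ^ 4 + 1))]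
          ring
      _ ≤ _ := by
          gcongr S * Real.exp ?_
          linarith
  -- On the cube the slope of the weight is at most 3x + 1/2 ≤ 4x, which the decay rate 4 can
  -- absorb.
  have hZ : ∀ t ∈ ({0, 1} : Set ℝ), ∀ j ∈ latticeCube d (n ^ 4), ∀ m : Fin d → ℤ,
      (∀ i, |m i - j i| ≤ 1) →
      Real.exp (spatialWeight (3 * x) κ k j) * ‖u t m‖ ≤ S * Real.exp (4 * n * x + 4 * x) := by
    intro t ht j hj m hm
    have hut : ∀ j, ‖u t j‖
        ≤ S * Real.exp (-(4 * latticeNorm j * Real.log (latticeNorm j + 1))) := by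
      rcases ht with rfl | rfl
      · exact h0
      · exact h1
    have hjk : |(j k : ℝ)| ≤ (n : ℝ) ^ 4 := by exact_mod_cast mem_latticeCube.1 hj k
    have w1 := spatialWeight_le (a := 3 * x) (by linarith) hκ0 k hjk
    have hmk : |(j k : ℝ)| ≤ |(m k : ℝ)| + 1 := by
      have h2 := abs_sub_abs_le_abs_sub (j k) (m k)
      rw [abs_sub_comm] at h2
      have h3 : |j k| ≤ |m k| + 1 := by linarith [hm k]
      exact_mod_cast h3
    have w2 : (3 * x + κ * (n : ℝ) ^ 4 / 2) * |(j k : ℝ)| ≤ 4 * x * (|(m k : ℝ)| + 1) := by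
      refine mul_le_mul ?_ hmk (abs_nonneg _) (by linarith)
      rw [hκN]
      linarith
    have w3 := exp_mul_le_of_decay hS hut hn1 m k
    calc Real.exp (spatialWeight (3 * x) κ k j) * ‖u t m‖
        ≤ Real.exp (4 * x * |(m k : ℝ)| + 4 * x) * ‖u t m‖ := by
          gcongr
          linarith
      _ = Real.exp (4 * x) * (Real.exp (4 * x * |(m k : ℝ)|) * ‖u t m‖) := by
          rw [Real.exp_add]
          ring
      _ ≤ Real.exp (4 * x) * (S * Real.exp (4 * n * x)) := by gcongr
      _ = _ := by
          rw [Real.exp_add]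
          ring
  have main := carleman_inequality h (a := 3 * x) (κ := κ) (β := Real.exp (-4) / 4 * n ^ 2)
    (t₀ := t₀) (G := 2 * κ * Real.exp (2 * (3 * x) - 4)) (c := c) (δ := δ) (ε := ε)
    (X := S * Real.exp (-(x * n ^ 4) + (4 * d + L + 2) * n ^ 4 + 4 * n * x + 3 * x))
    (Z := S * Real.exp (4 * n * x + 4 * x)) hκ0 (by positivity) (by positivity) (by positivity) k
    (Q := latticeCube d (n ^ 4)) (Q' := latticeCube d (n ^ 4 + 1))
    (fun j hj => mem_latticeCube_succ hj (by simp))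
    (fun j hj l => mem_latticeCube_succ hj (abs_add_single_sub_le j l))
    (fun j hj l => mem_latticeCube_succ hj (abs_sub_single_sub_le j l))
    (fun j hj => le_commDiag hκ0 (M := (n : ℝ) ^ 4) (by rw [mul_add, hκN]; linarith) k
      (by exact_mod_cast mem_latticeCube.1 hj k))
    -- β uses half of the commutator e⁻⁴n²; `hnL` makes the other half cover L² + 1 and e^κ - e^{-κ}
    -- < 3.
    (by
      have e1 : 2 * κ * Real.exp (2 * (3 * x) - 4) = 2 * (Real.exp (-4) * n ^ 2) := by
        rw [sub_eq_add_neg, Real.exp_add, hexp6, hκ]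
        field_simp
      have e2 := Real.exp_le_exp.2 hκ1
      have e3 := Real.exp_one_lt_d9
      have e4 := Real.exp_pos (-κ)
      rw [e1]
      linarith)
    (fun t ht j l hjl => hX t ht j _ (abs_add_single_sub_le j l) hjl)
    (fun t ht j l hjl => hX t ht j _ (abs_sub_single_sub_le j l) hjl)
    (fun t ht j hj => hZ t ht j hj j (by simp))
    (fun t ht j hj l => hZ t ht j hj _ (abs_add_single_sub_le j l))
    (fun t ht j hj l => hZ t ht j hj _ (abs_sub_single_sub_le j l))
    hc0 hct hct' hδ hδc hε hj₀ hu
  rw [card_latticeCube, card_latticeCube] at main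
  push_cast at main
  rw [show 2 * ((n : ℝ) ^ 4 + 1) + 1 = 2 * (n : ℝ) ^ 4 + 3 by ring] at main
  refine le_trans ?_ main
  have hw : (n ^ (3 * (j₀ k).natAbs) : ℝ)⁻¹ ≤ Real.exp (spatialWeight (3 * x) κ k j₀) := by
    have e1 := neg_le_spatialWeight (a := 3 * x) (by linarith) hκ0 k j₀
    refine le_trans (le_of_eq ?_) (Real.exp_le_exp.2 e1)
    rw [Real.exp_neg]
    congr 1
    have e2 : |(j₀ k : ℝ)| = ((j₀ k).natAbs : ℝ) := by
      rw [Nat.cast_natAbs]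
      simp
    rw [e2, show 3 * x * ((j₀ k).natAbs : ℝ) = ((3 * (j₀ k).natAbs : ℕ) : ℝ) * x by
      push_cast; ring, Real.exp_nat_mul, Real.exp_log hn0]
  gcongr

/-! ### Limit n → ∞ and the contradiction -/

theorem two_mul_pow_add_three_pow_le {n : ℝ} (hn : 1 ≤ n) (d : ℕ) :
    (2 * n ^ 4 + 3) ^ d ≤ 5 ^ d * n ^ (4 * d) := by
  have : 1 ≤ n ^ 4 := one_le_pow₀ hn
  rw [pow_mul, ← mul_pow]
  gcongr
  linarith

/-- The factor e^w n^{6r} is what clearing the left side of the Carleman inequality brings over. -/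
theorem boundary_term_le {n S y w : ℝ} {d r : ℕ} (hn : 1 ≤ n) (hw : w + 2 * y ≤ -n) :
    (2 * n ^ 4 + 3) ^ d * (2 * d * (S * Real.exp y)) ^ 2 * (Real.exp w * n ^ (6 * r))
      ≤ 5 ^ d * (2 * d * S) ^ 2 * (n ^ (6 * r + 4 * d + 2) * Real.exp (-n)) := by
  have h1 := two_mul_pow_add_three_pow_le hn d
  have h2 : 1 ≤ n ^ 2 := one_le_pow₀ hn
  calc (2 * n ^ 4 + 3) ^ d * (2 * d * (S * Real.exp y)) ^ 2 * (Real.exp w * n ^ (6 * r))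
      = (2 * n ^ 4 + 3) ^ d * (2 * d * S) ^ 2 * n ^ (6 * r) * Real.exp (w + 2 * y) := by
        rw [Real.exp_add, show 2 * y = ((2 : ℕ) : ℝ) * y by norm_num, Real.exp_nat_mul]
        ring
    _ ≤ (5 ^ d * n ^ (4 * d)) * (2 * d * S) ^ 2 * n ^ (6 * r) * Real.exp (-n) := by gcongr
    _ = 5 ^ d * (2 * d * S) ^ 2 * (n ^ (6 * r + 4 * d) * 1 * Real.exp (-n)) := by ring
    -- The spare n² only matches the power in `endpoint_term_le`.
    _ ≤ 5 ^ d * (2 * d * S) ^ 2 * (n ^ (6 * r + 4 * d) * n ^ 2 * Real.exp (-n)) := by gcongr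
    _ = _ := by ring

theorem endpoint_term_le {n S y w z γ : ℝ} {d r : ℕ} (hn : 1 ≤ n) (hγ : 0 ≤ γ)
    (hw : w + (z + 2 * y) ≤ -n) :
    2 * (Real.exp z * ((2 * n ^ 4 + 1) ^ d
        * ((4 * d + 2 * (γ * n ^ 2)) * (S * Real.exp y) ^ 2))) * (Real.exp w * n ^ (6 * r))
      ≤ 2 * (5 ^ d * ((4 * d + 2 * γ) * S ^ 2))
        * (n ^ (6 * r + 4 * d + 2) * Real.exp (-n)) := by
  have h1 : (2 * n ^ 4 + 1) ^ d ≤ 5 ^ d * n ^ (4 * d) := by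
    refine le_trans ?_ (two_mul_pow_add_three_pow_le hn d)
    gcongr
    norm_num
  have h2 : 4 * d + 2 * (γ * n ^ 2) ≤ (4 * d + 2 * γ) * n ^ 2 := by
    have := mul_le_mul_of_nonneg_left (one_le_pow₀ hn : 1 ≤ n ^ 2)
      (show 0 ≤ 4 * (d : ℝ) by positivity)
    linarith
  calc 2 * (Real.exp z * ((2 * n ^ 4 + 1) ^ d
        * ((4 * d + 2 * (γ * n ^ 2)) * (S * Real.exp y) ^ 2))) * (Real.exp w * n ^ (6 * r))
      = 2 * ((2 * n ^ 4 + 1) ^ d * ((4 * d + 2 * (γ * n ^ 2)) * S ^ 2)) * n ^ (6 * r)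
        * Real.exp (w + (z + 2 * y)) := by
        rw [Real.exp_add, Real.exp_add, show 2 * y = ((2 : ℕ) : ℝ) * y by norm_num,
          Real.exp_nat_mul]
        ring
    _ ≤ 2 * ((5 ^ d * n ^ (4 * d)) * ((4 * d + 2 * γ) * n ^ 2 * S ^ 2)) * n ^ (6 * r)
        * Real.exp (-n) := by gcongr
    _ = _ := by ring

/-- A solution decaying superexponentially at both times vanishes at all intermediate times. -/
theorem IsSchrodingerSolution.eq_zero_of_decay (h : IsSchrodingerSolution L U u u') (hL : 0 ≤ L)
    (hS : 0 ≤ S)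
    (h0 : ∀ j, ‖u 0 j‖ ≤ S * Real.exp (-(4 * latticeNorm j * Real.log (latticeNorm j + 1))))
    (h1 : ∀ j, ‖u 1 j‖ ≤ S * Real.exp (-(4 * latticeNorm j * Real.log (latticeNorm j + 1))))
    (k : Fin d) {t₀ : ℝ} (ht₀ : t₀ ∈ Ioo (0 : ℝ) 1) (j₀ : Fin d → ℤ) : u t₀ j₀ = 0 := by
  by_contra hne
  set c := min t₀ (1 - t₀) with hc
  have hc0 : 0 < c := lt_min ht₀.1 (by linarith [ht₀.2])
  set ε := ‖u t₀ j₀‖ / 2 with hε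
  have hε0 : 0 < ε := half_pos (norm_pos_iff.2 hne)
  -- Strictness of δ < c creates the exponential gap A n² between interior and endpoint times.
  obtain ⟨δ, hδ0, hδc, hu⟩ : ∃ δ, 0 < δ ∧ δ < c ∧
      ∀ t ∈ Icc (t₀ - δ) (t₀ + δ), ε ≤ ‖u t j₀‖ := by
    have hcont : ContinuousAt (fun τ => ‖u τ j₀‖) t₀ :=
      ((h.hasDeriv t₀ (Ioo_subset_Icc_self ht₀) j₀).hasDerivAt
        (Icc_mem_nhds ht₀.1 ht₀.2)).continuousAt.norm
    have hev := hcont.eventually (lt_mem_nhds (half_lt_self (norm_pos_iff.2 hne)))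
    obtain ⟨η, hη, hball⟩ := Metric.eventually_nhds_iff.1 hev
    refine ⟨min η c / 2, by positivity, ?_, fun t ht => (hball ?_).le⟩
    · linarith [min_le_right η c]
    · rw [Real.dist_eq, abs_lt]
      have := min_le_left η c
      constructor <;> linarith [ht.1, ht.2]
  set γ := Real.exp (-4) / 4 with hγ
  have hγ0 : 0 < γ := by positivity
  set r := (j₀ k).natAbs with hr
  set A := 2 * γ * (c ^ 2 - δ ^ 2) with hA
  have hA0 : 0 < A := by
    have : δ ^ 2 < c ^ 2 := pow_lt_pow_left₀ hδc hδ0.le two_ne_zero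
    have : 0 < c ^ 2 - δ ^ 2 := by linarith
    positivity
  set K := 5 ^ d * (2 * d * S) ^ 2 + 2 * (5 ^ d * ((4 * d + 2 * γ) * S ^ 2)) with hK
  have hlim : Tendsto (fun n : ℕ => K * ((n : ℝ) ^ (6 * r + 4 * d + 2) * Real.exp (-(n : ℝ))))
      atTop (𝓝 0) := by
    simpa using ((Real.tendsto_pow_mul_exp_neg_atTop_nhds_zero (6 * r + 4 * d + 2)).comp
      tendsto_natCast_atTop_atTop).const_mul K
  have hnat : Tendsto (fun n : ℕ => (n : ℝ)) atTop atTop := tendsto_natCast_atTop_atTop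
  -- A/32 turns the endpoint growth 16 n log n into at most A n²/2; 2/A in `ev3` makes the other
  -- half exceed n.
  have ev1 : ∀ᶠ n : ℕ in atTop, Real.log n ≤ A / 32 * n := by
    have := (Real.isLittleO_log_id_atTop.comp_tendsto hnat).bound (show 0 < A / 32 by positivity)
    filter_upwards [this] with n hn
    simpa using (le_abs_self _).trans hn
  -- Here 7 bounds 4nx + 3x by 7n⁴, γδ² pays for the Gaussian at δ, and the final 1 leaves the
  -- decay.
  have ev2 : ∀ᶠ n : ℕ in atTop, 4 * d + L + 2 + 7 + γ * δ ^ 2 + 1 ≤ Real.log n :=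
    (Real.tendsto_log_atTop.comp hnat).eventually_ge_atTop _
  have ev3 : ∀ᶠ n : ℕ in atTop, 2 / A + 2 * (L ^ 2 + 4) / Real.exp (-4) + 2 ≤ (n : ℝ) :=
    hnat.eventually_ge_atTop _
  have ev4 : ∀ᶠ n : ℕ in atTop, ∑ l, (j₀ l).natAbs ≤ n := eventually_ge_atTop _
  have ev5 := hlim.eventually (gt_mem_nhds (show 0 < ε ^ 2 * (2 * δ) by positivity))
  obtain ⟨n, e1, e2, e3, e4, e5⟩ := (ev1.and (ev2.and (ev3.and (ev4.and ev5)))).exists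
  set x := Real.log n with hx
  have p1 : 0 ≤ 2 / A := by positivity
  have p2 : 0 ≤ 2 * (L ^ 2 + 4) / Real.exp (-4) := by positivity
  have hn2 : (2 : ℝ) ≤ n := by linarith
  have hn1 : (1 : ℝ) ≤ n := by linarith
  have hn0 : (0 : ℝ) < n := by linarith
  have hx0 : 0 ≤ x := Real.log_nonneg hn1
  have hxn : x ≤ n := (Real.log_le_sub_one_of_pos hn0).trans (by linarith)
  have hn14 : (n : ℝ) ≤ (n : ℝ) ^ 4 := le_self_pow₀ hn1 (by norm_num)
  have hn24 : (n : ℝ) ^ 2 ≤ (n : ℝ) ^ 4 := pow_le_pow_right₀ hn1 (by norm_num)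
  have hcube : j₀ ∈ latticeCube d (n ^ 4) := by
    refine mem_latticeCube.2 fun l => ?_
    have a1 : (j₀ l).natAbs ≤ ∑ l, (j₀ l).natAbs :=
      Finset.single_le_sum (f := fun l => (j₀ l).natAbs) (fun _ _ => Nat.zero_le _)
        (Finset.mem_univ l)
    have a2 : n ≤ n ^ 4 := Nat.le_self_pow (by norm_num) n
    rw [Int.abs_eq_natAbs]
    exact_mod_cast a1.trans (e4.trans a2)
  have hnL : 2 * (L ^ 2 + 4) ≤ Real.exp (-4) * (n : ℝ) ^ 2 := by
    have a1 : 2 * (L ^ 2 + 4) / Real.exp (-4) ≤ n := by linarith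
    rw [div_le_iff₀' (Real.exp_pos _)] at a1
    refine a1.trans ?_
    gcongr
    exact le_self_pow₀ hn1 two_ne_zero
  have main := carleman_inequality_scaled h hL hS h0 h1 hc0.le (min_le_left _ _)
    (min_le_right _ _) hδ0.le hδc.le hε0.le k hu (by exact_mod_cast hn2) hcube hnL
  rw [← hγ, ← hr, ← hx] at main
  have q1 : 2 * γ * n ^ 2 * δ ^ 2 + 2 * (-(x * n ^ 4) + (4 * d + L + 2) * n ^ 4 + 4 * n * x
      + 3 * x) ≤ -n := by
    have a1 : 4 * n * x + 3 * x ≤ 7 * (n : ℝ) ^ 4 := by nlinarith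
    have a2 : γ * δ ^ 2 * n ^ 2 ≤ γ * δ ^ 2 * (n : ℝ) ^ 4 := by gcongr
    have a3 := mul_le_mul_of_nonneg_right e2 (show 0 ≤ (n : ℝ) ^ 4 by positivity)
    linarith
  have q2 : 2 * γ * n ^ 2 * δ ^ 2 + (-2 * (γ * n ^ 2) * c ^ 2 + 2 * (4 * n * x + 4 * x)) ≤ -n := by
    have a1 : 2 * (4 * n * x + 4 * x) ≤ 16 * n * x := by nlinarith
    have a2 := mul_le_mul_of_nonneg_left e1 (show 0 ≤ 16 * (n : ℝ) by positivity)
    have a3 : 2 / A ≤ n := by linarith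
    rw [div_le_iff₀' hA0] at a3
    have a4 := mul_le_mul_of_nonneg_right a3 hn0.le
    have a5 : 2 * γ * n ^ 2 * δ ^ 2 + -2 * (γ * n ^ 2) * c ^ 2 = -(A * n ^ 2) := by
      rw [hA]
      ring
    linarith
  -- Y² is the reciprocal of the squared weight on the left side of `main`.
  set Y := Real.exp (γ * n ^ 2 * δ ^ 2) * (n : ℝ) ^ (3 * r) with hY
  have hY0 : 0 < Y := by positivity
  have lhs : (Real.exp (-(γ * n ^ 2) * δ ^ 2) * ((n : ℝ) ^ (3 * r))⁻¹ * ε) ^ 2 * (2 * δ)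
      = ε ^ 2 * (2 * δ) / Y ^ 2 := by
    rw [hY, neg_mul, Real.exp_neg]
    field_simp
  rw [lhs, div_le_iff₀ (by positivity)] at main
  have hY2 : Y ^ 2 = Real.exp (2 * γ * n ^ 2 * δ ^ 2) * (n : ℝ) ^ (6 * r) := by
    rw [hY, mul_pow, ← Real.exp_nat_mul, ← pow_mul]
    congr 2
    · push_cast
      ring
    · ring
  have hT1 : (2 * (n : ℝ) ^ 4 + 3) ^ d * (2 * d * (S * Real.exp (-(x * n ^ 4)
          + (4 * d + L + 2) * n ^ 4 + 4 * n * x + 3 * x))) ^ 2 * Y ^ 2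
      ≤ 5 ^ d * (2 * d * S) ^ 2 * ((n : ℝ) ^ (6 * r + 4 * d + 2) * Real.exp (-(n : ℝ))) := by
    rw [hY2]
    exact boundary_term_le hn1 q1
  have hT2 : 2 * (Real.exp (-2 * (γ * n ^ 2) * c ^ 2) * ((2 * (n : ℝ) ^ 4 + 1) ^ d
          * ((4 * d + 2 * (γ * n ^ 2)) * (S * Real.exp (4 * n * x + 4 * x)) ^ 2))) * Y ^ 2
      ≤ 2 * (5 ^ d * ((4 * d + 2 * γ) * S ^ 2))
        * ((n : ℝ) ^ (6 * r + 4 * d + 2) * Real.exp (-(n : ℝ))) := by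
    rw [hY2]
    exact endpoint_term_le hn1 hγ0.le q2
  rw [hK, add_mul] at e5
  rw [add_mul] at main
  linarith

end Uniqueness

/-! ### Reduction of the theorem to pointwise decay -/

/-- Each term of the nonnegative series is at most its sum; the square root turns the rate 2μ into μ
≥ 4. -/
theorem exp_decay_of_summable {d : ℕ} {μ : ℝ} (hμ : 4 ≤ μ) (v w : (Fin d → ℤ) → ℂ)
    (hs : Summable fun j : Fin d → ℤ =>
      Real.exp (2 * μ * latticeNorm j * Real.log (latticeNorm j + 1))
        * (‖v j‖ ^ 2 + ‖w j‖ ^ 2)) :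
    ∃ S : ℝ, 0 ≤ S ∧
      (∀ j, ‖v j‖ ≤ S * Real.exp (-(4 * latticeNorm j * Real.log (latticeNorm j + 1)))) ∧
      ∀ j, ‖w j‖ ≤ S * Real.exp (-(4 * latticeNorm j * Real.log (latticeNorm j + 1))) := by
  refine ⟨√(∑' j, Real.exp (2 * μ * latticeNorm j * Real.log (latticeNorm j + 1))
        * (‖v j‖ ^ 2 + ‖w j‖ ^ 2)), Real.sqrt_nonneg _, ?_⟩
  have key : ∀ (j : Fin d → ℤ) (z : ℝ), 0 ≤ z → z ^ 2 ≤ ‖v j‖ ^ 2 + ‖w j‖ ^ 2 →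
      z ≤ √(∑' j, Real.exp (2 * μ * latticeNorm j * Real.log (latticeNorm j + 1))
        * (‖v j‖ ^ 2 + ‖w j‖ ^ 2))
        * Real.exp (-(4 * latticeNorm j * Real.log (latticeNorm j + 1))) := by
    intro j z hz hzle
    rw [Real.exp_neg, ← div_eq_mul_inv, le_div_iff₀ (Real.exp_pos _)]
    refine Real.le_sqrt_of_sq_le ?_
    refine le_trans ?_ (hs.le_tsum j fun _ _ => by positivity)
    have hρ := latticeNorm_nonneg j
    have hlog : 0 ≤ Real.log (latticeNorm j + 1) := Real.log_nonneg (by linarith)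
    rw [mul_pow, ← Real.exp_nat_mul, mul_comm]
    have h1 : ((2 : ℕ) : ℝ) * (4 * latticeNorm j * Real.log (latticeNorm j + 1))
        ≤ 2 * μ * latticeNorm j * Real.log (latticeNorm j + 1) := by
      have := mul_le_mul_of_nonneg_right hμ (mul_nonneg hρ hlog)
      push_cast
      linarith
    exact mul_le_mul (Real.exp_le_exp.2 h1) hzle (sq_nonneg _) (Real.exp_pos _).le
  exact ⟨fun j => key j _ (norm_nonneg _) (by linarith [sq_nonneg ‖w j‖]),
    fun j => key j _ (norm_nonneg _) (by linarith [sq_nonneg ‖v j‖])⟩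

/-- The time derivative is the derivative within `[0,1]` of the `ℓ²(ℤ^d)`-valued map `u`. -/
theorem theorem1p2 (d : ℕ) (hd : 1 ≤ d) :
    ∃ μ₀ : ℝ, ∀ (u : ℝ → EllTwo d) (V : ℝ → (Fin d → ℤ) → ℂ),
      ContDiffOn ℝ 1 u (Icc (0 : ℝ) 1) →
      (∃ L : ℝ, ∀ t ∈ Icc (0 : ℝ) 1, ∀ j : Fin d → ℤ, ‖V t j‖ ≤ L) →
      (∀ t ∈ Icc (0 : ℝ) 1, ∀ j : Fin d → ℤ,
        ‖Complex.I * (derivWithin u (Icc (0 : ℝ) 1) t : EllTwo d) j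
            + discreteLaplacian (fun m => u t m) j‖ ≤ ‖V t j * u t j‖) →
      ∀ μ : ℝ, μ₀ < μ →
        Summable (fun j : Fin d → ℤ =>
          Real.exp (2 * μ * latticeNorm j * Real.log (latticeNorm j + 1))
            * (‖u 0 j‖ ^ 2 + ‖u 1 j‖ ^ 2)) →
        ∀ t ∈ Icc (0 : ℝ) 1, u t = 0 := by
  -- 4 is the weight slope 3 plus a margin of 1 at the cube's boundary; slope 3 makes the commutator
  -- n⁶ · n⁻⁴ = n² beat n log n.
  refine ⟨4, fun u V hu ⟨L, hV⟩ hineq μ hμ hs => ?_⟩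
  obtain ⟨S, hS, h0, h1⟩ := exp_decay_of_summable hμ.le (fun j => u 0 j) (fun j => u 1 j) hs
  obtain ⟨U, hU⟩ := isCompact_Icc.exists_bound_of_continuousOn hu.continuousOn
  have hL : 0 ≤ L := (norm_nonneg _).trans (hV 0 (by simp) 0)
  have hsol : IsSchrodingerSolution L U (fun t j => u t j)
      (fun t j => (derivWithin u (Icc (0 : ℝ) 1) t : EllTwo d) j) := by
    refine ⟨fun t ht j => ?_, fun t ht j => ?_, fun t ht j => ?_⟩
    · have hd := ((hu.differentiableOn one_ne_zero) t ht).hasDerivWithinAt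
      exact ((lp.evalCLM ℂ (fun _ : Fin d → ℤ => ℂ) 2 j).restrictScalars
        ℝ).hasFDerivAt.comp_hasDerivWithinAt t hd
    · exact (lp.norm_apply_le_norm two_ne_zero (u t) j).trans (hU t ht)
    · refine (hineq t ht j).trans ?_
      rw [norm_mul]
      exact mul_le_mul_of_nonneg_right (hV t ht j) (norm_nonneg _)
  have hopen : ∀ t ∈ Ioo (0 : ℝ) 1, u t = 0 := fun t ht => by
    refine lp.ext (funext fun j => ?_)
    -- Any coordinate direction serves for the weight; one exists since d ≥ 1.
    exact hsol.eq_zero_of_decay hL hS h0 h1 ⟨0, hd⟩ ht j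
  intro t ht
  -- The times 0 and 1 follow by continuity.
  have hclos : t ∈ closure (Ioo (0 : ℝ) 1) := by rwa [closure_Ioo zero_ne_one]
  have hEq : EqOn u 0 (closure (Ioo (0 : ℝ) 1)) :=
    EqOn.of_subset_closure (s := Ioo (0 : ℝ) 1) (fun t ht => hopen t ht)
      (by rw [closure_Ioo zero_ne_one]; exact hu.continuousOn) continuousOn_const
      subset_closure subset_rfl
  exact hEq hclos
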